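/- Let $\lambda>0$, $\lambda\neq 1$. Consider $\lambda$-homogeneous stream functions $\Psi(r,\theta)=r^{\lambda}\psi(\theta)$, with velocity $u=\nabla^\perp\Psi$ and pressure $p=r^{2\lambda-2}P$, $P\in\mathbb R$ constant, for which the stationary Euler equation reduces to the profile equation $$2(\lambda-1)P=-(\lambda-1)(\psi')^2+\lambda^2\psi^2+\lambda\psi''\psi .$$ A function $\psi\in H^1_{loc}(\mathbb R)$ (continuous representative) is called a solution if for some $P\in\mathbb R$ the equation holds in the weak form $$\int_{\mathbb R}\Big(\big[-(2\lambda-1)(\psi')^2+\lambda^2\psi^2\big]\varphi-\lambda\psi\psi'\varphi'\Big)\,d\theta=2(\lambda-1)P\int_{\mathbb R}\varphi\,d\theta\qquad\text{for all }\varphi\in C_c^\infty(\mathbb R).$$ A solution is elliptic if $\psi$ vanishes nowhere on $\mathbb{R}$, and trivial (rotational) if $\psi$ is constant. It yields a velocity field on the plane when it is $2\pi$-periodic. Solutions are counted up to the symmetries of the equation: scaling $\psi\mapsto\alpha\psi$ ($\alpha\in\mathbb R\setminus\{0\}$), rotation $\psi\mapsto\psi(\cdot-\theta_0)$ and reflection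 $\psi\mapsto\psi(-\,\cdot)$. Then: (0) Every non-zero constant $\psi$ is an elliptic solution. (1) If $\lambda\in[4/3,2)\cup(2,9/2]$, there are no non-trivial $2\pi$-periodic elliptic solutions. (2) If $\lambda>2$, the number of non-trivial $2\pi$-periodic elliptic solutions, up to symmetries, equals the cardinality of $(2,\sqrt{2\lambda})\cap\mathbb N$. (So such solutions exist precisely when $\lambda>9/2$, in the range $\lambda>2$.) (3) If $\lambda=2$, all elliptic solutions are $2\pi$-periodic; they are exactly the functions $\psi(\theta)=\gamma_1+\gamma_2\cos(2(\theta-\theta_0))$ with $|\gamma_2|<|\gamma_1|$, $\theta_0\in\mathbb R$. (4) If $\lambda=1/2$, all elliptic solutions are $2\pi$-periodic; they are exactly the functions $\psi(\theta)=\pm\sqrt{\gamma_1+\gamma_2\cos(\theta-\theta_0)}$ with $|\gamma_2|<\gamma_1$, $\theta_0\in\mathbb R$. (5) If $\lambda\in(0,1/2)\cup(1/2,3/4]$, there are no non-trivial $2\pi$-periodic elliptic solutions. -/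

import Mathlib

open scoped ContDiff

/-- `ψ` (the angular profile of the stream function `Ψ(r, θ) = r ^ lam * ψ θ`) is a weak solution on
the real line, with constant pressure `P`, of
`2 (lam - 1) P = -(lam - 1) ψ' ^ 2 + lam ^ 2 ψ ^ 2 + lam ψ'' ψ`.

The first two fields say that `ψ` is (the continuous representative of a function) of class `H¹` on
every bounded interval; its weak derivative is then the almost everywhere defined `deriv ψ`.
The third field is the distributional form
`2 (lam - 1) P = -(2 lam - 1) ψ' ^ 2 + lam ^ 2 ψ ^ 2 - lam ψ ψ' ∂_θ`.
The weak solutions in `H¹` of the circle are exactly the `2π`-periodic ones. -/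
structure IsProfile (lam P : ℝ) (ψ : ℝ → ℝ) : Prop where
  absCont : ∀ a b : ℝ, AbsolutelyContinuousOnInterval ψ a b
  memLp_deriv : ∀ a b : ℝ,
    MeasureTheory.MemLp (deriv ψ) 2 (MeasureTheory.volume.restrict (Set.Icc a b))
  weak_eq : ∀ φ : ℝ → ℝ, ContDiff ℝ ∞ φ → HasCompactSupport φ →
    ∫ θ, ((-(2 * lam - 1) * deriv ψ θ ^ 2 + lam ^ 2 * ψ θ ^ 2) * φ θ
        - lam * ψ θ * deriv ψ θ * deriv φ θ)
      = 2 * (lam - 1) * P * ∫ θ, φ θ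

/-- Elliptic solutions: the profile vanishes nowhere. -/
def IsElliptic (lam : ℝ) (ψ : ℝ → ℝ) : Prop :=
  (∃ P : ℝ, IsProfile lam P ψ) ∧ ∀ θ, ψ θ ≠ 0

/-- The non-trivial (that is, non-rotational: `ψ` is not constant) elliptic solutions which are
`2π`-periodic, so that they define a velocity field on the plane. -/
def nontrivialElliptic (lam : ℝ) : Set (ℝ → ℝ) :=
  {ψ | IsElliptic lam ψ ∧ Function.Periodic ψ (2 * Real.pi) ∧ ¬ ∃ c : ℝ, ∀ θ, ψ θ = c}

/-- Two profiles agree up to the symmetries of the equation: scaling by a non-zero constant,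
rotation, and reflection. -/
def SymmEquiv (ψ φ : ℝ → ℝ) : Prop :=
  ∃ α : ℝ, α ≠ 0 ∧ ∃ s : ℝ, (s = 1 ∨ s = -1) ∧ ∃ θ₀ : ℝ, ∀ θ, φ θ = α * ψ (s * θ - θ₀)

theorem symmEquiv_equivalence : Equivalence SymmEquiv where
  refl ψ := ⟨1, one_ne_zero, 1, Or.inl rfl, 0, fun θ => by simp⟩
  symm := by
    rintro ψ φ ⟨α, hα, s, hs, t, h⟩
    have hss : s * s = 1 := by rcases hs with rfl | rfl <;> norm_num
    refine ⟨α⁻¹, inv_ne_zero hα, s, hs, -(s * t), fun θ => ?_⟩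
    rw [h, inv_mul_cancel_left₀ hα]
    congr 1
    linear_combination (-θ - t) * hss
  trans := by
    rintro ψ φ χ ⟨α, hα, s, hs, t, h⟩ ⟨β, hβ, s', hs', t', h'⟩
    refine ⟨β * α, mul_ne_zero hβ hα, s * s', ?_, s * t' + t, fun θ => ?_⟩
    · rcases hs with rfl | rfl <;> rcases hs' with rfl | rfl <;> norm_num
    · rw [h', h, mul_assoc]
      congr 3
      ring

/-- Profiles modulo the symmetries of the equation. -/
def symmSetoid : Setoid (ℝ → ℝ) := ⟨SymmEquiv, symmEquiv_equivalence⟩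

/-! Where `ψ` does not vanish, the weak equation is classical (`IsProfile.classical`). A positive
profile then satisfies two semilinear equations. Keeping `P`, the power `h = ψ ^ (1 / lam)` solves
`h'' = k h ^ (1 - 2 lam) - h` with `k = 2 (lam - 1) P / lam ^ 2`. Eliminating `P` through a first
integral gives `ψ'' = c ψ ^ (1 - 2 / lam) - lam ^ 2 ψ`, i.e. vorticity is a function of the stream
function. The first equation is linear in `h` for `lam = 1 / 2` and the second in `ψ` for `lam = 2`,
whence the explicit families.

Solutions are symmetric about critical points, so the distance between successive ones is half a
period. Both `h'` and `h h'` solve linear equations `v'' = -Q v`, with `Q = 1 - (1 - 2 lam) k h ^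
(-2 lam)` and `Q = 4 - 2 (2 - lam) k h ^ (-2 lam)`; periodicity forces `k > 0`. Sturm comparison
with `sin t` and `sin 2t` places the minimal period of a non-constant periodic solution above `2π`
for `lam < 1 / 2`, strictly between `π` and `2π` for `1 / 2 < lam < 2`, and below `π` for `lam > 2`.
The first two cases exclude the period `2π`.

For `lam > 2`, scaling leads to `u'' = u ^ q - u` with `q = 1 - 2 / lam` in `(0, 1)`. Its
non-constant periodic positive orbits are labelled by an amplitude `r` in `(0, amp q)`. The period
increases strictly with `r` (`strictMonoOn_period`, from `period_inequality`), and starts from the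
linearised value, which is `2π / √(2 lam)` for the profile. Orbits passing close to `0` have profile
period above `2π / 3` (`exists_lt_period`). Hence `2π / n` is the minimal period of a profile
exactly for `2 < n < √(2 lam)`, and for one amplitude only. Symmetries preserve periods, so
different `n` give inequivalent profiles. -/

open MeasureTheory Set

/-! ### Weak and classical profiles. -/

/-- A primitive of a smooth compactly supported function of zero mean is a test function. -/
theorem exists_hasDerivAt_of_integral_eq_zero {χ : ℝ → ℝ} (hχ : ContDiff ℝ ∞ χ)
    (hc : HasCompactSupport χ) (h0 : ∫ x, χ x = 0) :
    ∃ Φ : ℝ → ℝ, ContDiff ℝ ∞ Φ ∧ HasCompactSupport Φ ∧ deriv Φ = χ := by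
  obtain ⟨R, hR⟩ := hc.isCompact.isBounded.subset_closedBall 0
  have hz : ∀ x, R < |x| → χ x = 0 := by
    intro x hx
    by_contra hne
    have := hR (subset_tsupport χ hne)
    rw [Metric.mem_closedBall, Real.dist_eq, sub_zero] at this
    linarith
  set S := |R| + 1 with hS
  have hSR : R < S := by have := le_abs_self R; linarith
  have hS0 : 0 < S := by positivity
  have hder : ∀ x, HasDerivAt (fun y => ∫ t in (-S)..y, χ t) (χ x) x := fun x =>
    (hχ.continuous.integral_hasStrictDerivAt (-S) x).hasDerivAt
  have hderiv : deriv (fun y => ∫ t in (-S)..y, χ t) = χ := funext fun x => (hder x).deriv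
  refine ⟨fun y => ∫ t in (-S)..y, χ t, ?_, ?_, hderiv⟩
  · rw [contDiff_infty_iff_deriv, hderiv]
    exact ⟨fun x => (hder x).differentiableAt, hχ⟩
  · refine HasCompactSupport.intro (isCompact_Icc (a := -S) (b := S)) fun x hx => ?_
    rcases lt_or_ge x (-S) with h | h
    · rw [intervalIntegral.integral_symm, intervalIntegral.integral_zero_ae, neg_zero]
      refine Filter.Eventually.of_forall fun t ht => hz t ?_
      rw [uIoc_of_le h.le] at ht
      rcases eq_or_lt_of_le ht.2 with h' | h'
      · rw [h', abs_neg, abs_of_pos hS0]; exact hSR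
      · rw [abs_of_neg (by linarith)]; linarith
    · have hxS : S < x := by
        by_contra hcon
        exact hx ⟨h, not_lt.1 hcon⟩
      rw [intervalIntegral.integral_eq_integral_of_support_subset, h0]
      intro t ht
      have : |t| ≤ R := by
        by_contra hcon
        exact ht (hz t (not_le.1 hcon))
      have := abs_le.1 this
      constructor <;> linarith

/-- The du Bois-Reymond lemma on the real line. -/
theorem ae_eq_const_of_integral_mul_deriv_eq_zero {f : ℝ → ℝ} (hf : LocallyIntegrable f)
    (h : ∀ φ : ℝ → ℝ, ContDiff ℝ ∞ φ → HasCompactSupport φ → ∫ x, f x * deriv φ x = 0) :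
    ∃ c : ℝ, ∀ᵐ x, f x = c := by
  let b : ContDiffBump (0 : ℝ) := default
  have hρ : ContDiff ℝ ∞ (b.normed volume) := b.contDiff_normed
  have hρc : HasCompactSupport (b.normed volume) := b.hasCompactSupport_normed
  have hρ1 : ∫ x, b.normed volume x = 1 := b.integral_normed
  refine ⟨∫ x, f x * b.normed volume x, ?_⟩
  set c := ∫ x, f x * b.normed volume x
  refine ae_eq_of_integral_contDiff_smul_eq hf (locallyIntegrable_const c) fun g hg hgc => ?_
  have hgi : Integrable g := hg.continuous.integrable_of_hasCompactSupport hgc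
  have hρi : Integrable (b.normed volume) := hρ.continuous.integrable_of_hasCompactSupport hρc
  -- Subtracting a multiple of a bump of integral one makes `g` have zero mean, hence a derivative
  -- of a test function.
  obtain ⟨Φ, hΦ, hΦc, hΦd⟩ := exists_hasDerivAt_of_integral_eq_zero
    (χ := fun x => g x - (∫ y, g y) * b.normed volume x) (hg.sub (contDiff_const.mul hρ))
    (hgc.sub (hρc.mul_left (f := fun _ => ∫ y, g y))) (by
      rw [integral_sub hgi (hρi.const_mul _), integral_const_mul, hρ1]; ring)
  have key := h Φ hΦ hΦc
  rw [hΦd] at key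
  have i1 : Integrable fun x => f x * g x := by
    simpa [mul_comm] using hf.integrable_smul_left_of_hasCompactSupport hg.continuous hgc
  have i2 : Integrable fun x => f x * b.normed volume x := by
    simpa [mul_comm] using hf.integrable_smul_left_of_hasCompactSupport hρ.continuous hρc
  have : (fun x => f x * (g x - (∫ y, g y) * b.normed volume x))
      = fun x => f x * g x - (∫ y, g y) * (f x * b.normed volume x) := by
    funext x; ring
  rw [this, integral_sub i1 (i2.const_mul _), integral_const_mul] at key
  simp only [smul_eq_mul]
  rw [integral_mul_const]
  simp only [mul_comm (g _)]
  linarith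

/-- `B` is only locally integrable, so its primitive is merely absolutely continuous; integration by
parts in that class suffices, on an interval whose interior contains the support of `φ`. -/
theorem integral_integral_mul_deriv {B : ℝ → ℝ} (hB : LocallyIntegrable B) {φ : ℝ → ℝ}
    (hφ : ContDiff ℝ ∞ φ) (hc : HasCompactSupport φ) :
    ∫ x, (∫ t in (0 : ℝ)..x, B t) * deriv φ x = -∫ x, B x * φ x := by
  obtain ⟨R, hR⟩ := hc.isCompact.isBounded.subset_closedBall 0
  set S := |R| + 1 with hS
  have hSR : R < S := by have := le_abs_self R; linarith
  have hS0 : 0 < S := by positivity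
  have hts : tsupport φ ⊆ Ioo (-S) S := by
    intro x hx
    have := hR hx
    rw [Metric.mem_closedBall, Real.dist_eq, sub_zero] at this
    have := abs_le.1 this
    constructor <;> linarith
  have hBi : ∀ a b, IntervalIntegrable B volume a b := fun a b =>
    (hB.integrableOn_isCompact isCompact_uIcc).intervalIntegrable
  have hac := (hBi (-S) S).absolutelyContinuousOnInterval_intervalIntegral (c := 0)
    (by rw [uIcc_of_le (by linarith)]; constructor <;> linarith)
  have hφac : AbsolutelyContinuousOnInterval φ (-S) S :=
    (hφ.of_le (by simp)).contDiffOn.absolutelyContinuousOnInterval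
  have hφS : φ S = 0 := by
    by_contra hne
    exact lt_irrefl _ (hts (subset_tsupport φ hne)).2
  have hφS' : φ (-S) = 0 := by
    by_contra hne
    exact lt_irrefl _ (hts (subset_tsupport φ hne)).1
  have key := hac.integral_mul_deriv_eq_deriv_mul hφac
  rw [hφS, hφS', mul_zero, mul_zero, sub_zero, zero_sub] at key
  rw [← intervalIntegral.integral_eq_integral_of_support_subset (a := -S) (b := S), key,
    ← intervalIntegral.integral_eq_integral_of_support_subset (a := -S) (b := S)]
  · congr 1
    refine intervalIntegral.integral_congr_ae ?_
    filter_upwards [LocallyIntegrable.ae_hasDerivAt_integral hB] with x hx _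
    rw [(hx 0).deriv]
  · intro x hx
    have : φ x ≠ 0 := fun h0 => hx (by simp [h0])
    exact Ioo_subset_Ioc_self (hts (subset_tsupport φ this))
  · intro x hx
    have : deriv φ x ≠ 0 := fun h0 => hx (by simp [h0])
    exact Ioo_subset_Ioc_self (hts (support_deriv_subset this))

theorem IsProfile.continuous {lam P : ℝ} {ψ : ℝ → ℝ} (h : IsProfile lam P ψ) : Continuous ψ := by
  rw [continuous_iff_continuousAt]
  intro x
  refine (h.absCont (x - 1) (x + 1)).continuousOn.continuousAt ?_
  rw [uIcc_of_le (by linarith)]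
  exact Icc_mem_nhds (by linarith) (by linarith)

/-- Away from its zeros a weak solution is a classical one. -/
theorem IsProfile.classical {lam P : ℝ} {ψ : ℝ → ℝ} (h : IsProfile lam P ψ) (hlam : lam ≠ 0)
    (h0 : ∀ θ, ψ θ ≠ 0) :
    Differentiable ℝ ψ ∧ ∀ θ, HasDerivAt (deriv ψ)
      (((lam - 1) * deriv ψ θ ^ 2 - lam ^ 2 * ψ θ ^ 2 + 2 * (lam - 1) * P) / (lam * ψ θ)) θ := by
  have hcont := h.continuous
  have hmem : ∀ K : Set ℝ, IsCompact K → MemLp (deriv ψ) 2 (volume.restrict K) := by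
    intro K hK
    obtain ⟨R, hR⟩ := hK.isBounded.subset_closedBall 0
    rw [Real.closedBall_eq_Icc] at hR
    exact (h.memLp_deriv _ _).mono_measure (Measure.restrict_mono hR le_rfl)
  have hd2 : LocallyIntegrable fun θ => deriv ψ θ ^ 2 :=
    locallyIntegrable_iff.2 fun K hK => (hmem K hK).integrable_sq
  have hd1 : LocallyIntegrable (deriv ψ) := locallyIntegrable_iff.2 fun K hK =>
    haveI : IsFiniteMeasure (volume.restrict K) := ⟨by simpa using hK.measure_lt_top⟩
    (hmem K hK).integrable (by norm_num)
  set A : ℝ → ℝ := fun θ => lam * ψ θ * deriv ψ θ with hA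
  set B : ℝ → ℝ := fun θ =>
    -(2 * lam - 1) * deriv ψ θ ^ 2 + lam ^ 2 * ψ θ ^ 2 - 2 * (lam - 1) * P with hB
  have hAl : LocallyIntegrable A := by
    have := locallyIntegrableOn_univ.2 hd1
    refine locallyIntegrableOn_univ.1 (this.continuousOn_mul ?_ ?_)
    · exact (continuous_const.mul hcont).continuousOn
    · exact isOpen_univ.isLocallyClosed
  have hCl : LocallyIntegrable fun θ => lam ^ 2 * ψ θ ^ 2 - 2 * (lam - 1) * P :=
    Continuous.locallyIntegrable (by fun_prop)
  have hBl : LocallyIntegrable B := by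
    have := (hd2.smul (-(2 * lam - 1))).add hCl
    refine this.congr (Filter.Eventually.of_forall fun θ => ?_)
    simp [hB]; ring
  have hβc : Continuous fun x => ∫ t in (0 : ℝ)..x, B t :=
    intervalIntegral.continuous_primitive (fun a b =>
      (hBl.integrableOn_isCompact isCompact_uIcc).intervalIntegrable) 0
  -- The weak equation says that `A' = -B` in distributions, so `A` plus a primitive of `B` is
  -- constant.
  obtain ⟨c, hc⟩ := ae_eq_const_of_integral_mul_deriv_eq_zero
    (f := fun x => A x + ∫ t in (0 : ℝ)..x, B t) (hAl.add hβc.locallyIntegrable) (by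
      intro φ hφ hφc
      have hφ' : Continuous (deriv φ) := (hφ.continuous_deriv (by simp))
      have i1 : Integrable fun x => A x * deriv φ x := by
        simpa [mul_comm] using hAl.integrable_smul_left_of_hasCompactSupport hφ' hφc.deriv
      have i2 : Integrable fun x => (∫ t in (0 : ℝ)..x, B t) * deriv φ x := by
        simpa [mul_comm] using
          hβc.locallyIntegrable.integrable_smul_left_of_hasCompactSupport hφ' hφc.deriv
      have i3 : Integrable fun x => B x * φ x := by
        simpa [mul_comm] using
          hBl.integrable_smul_left_of_hasCompactSupport hφ.continuous hφc
      have i4 : Integrable φ := hφ.continuous.integrable_of_hasCompactSupport hφc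
      have key := h.weak_eq φ hφ hφc
      have e : (fun θ => (-(2 * lam - 1) * deriv ψ θ ^ 2 + lam ^ 2 * ψ θ ^ 2) * φ θ
          - lam * ψ θ * deriv ψ θ * deriv φ θ)
          = fun θ => (B θ * φ θ - A θ * deriv φ θ) + 2 * (lam - 1) * P * φ θ := by
        funext θ; simp only [hA, hB]; ring
      have s1 : ∫ θ, (B θ * φ θ - A θ * deriv φ θ) + 2 * (lam - 1) * P * φ θ
          = (∫ θ, (B θ * φ θ - A θ * deriv φ θ)) + ∫ θ, 2 * (lam - 1) * P * φ θ :=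
        integral_add (i3.sub i1) (i4.const_mul _)
      rw [e, s1, integral_sub i3 i1,
        integral_const_mul] at key
      simp only [add_mul]
      rw [integral_add i1 i2, integral_integral_mul_deriv hBl hφ hφc]
      linarith)
  -- Dividing by `lam * ψ`, which never vanishes, gives a continuous version of `deriv ψ`. Then `B`
  -- is continuous as well and `D` is differentiable.
  set D : ℝ → ℝ := fun x => (c - ∫ t in (0 : ℝ)..x, B t) / (lam * ψ x) with hD
  have hne : ∀ x, lam * ψ x ≠ 0 := fun x => mul_ne_zero hlam (h0 x)
  have hDc : Continuous D := (continuous_const.sub hβc).div (continuous_const.mul hcont) hne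
  have hDae : ∀ᵐ x, deriv ψ x = D x := by
    filter_upwards [hc] with x hx
    rw [hD, eq_div_iff (hne x)]
    simp only [hA] at hx
    linarith
  have hint : ∀ x, ψ x = ψ 0 + ∫ t in (0 : ℝ)..x, D t := by
    intro x
    have := (h.absCont 0 x).integral_deriv_eq_sub
    rw [← intervalIntegral.integral_congr_ae (f := deriv ψ) (hDae.mono fun t ht _ => ht)]
    linarith
  have hder : ∀ x, HasDerivAt ψ (D x) x := by
    intro x
    have := ((hDc.integral_hasStrictDerivAt 0 x).hasDerivAt).const_add (ψ 0)
    rwa [← funext hint] at this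
  have hdD : deriv ψ = D := funext fun x => (hder x).deriv
  have hBc : Continuous B := by
    rw [hB, hdD]; fun_prop
  refine ⟨fun x => (hder x).differentiableAt, fun x => ?_⟩
  have hβd := (hBc.integral_hasStrictDerivAt 0 x).hasDerivAt
  have hq := (hβd.const_sub c).div ((hder x).const_mul lam) (hne x)
  have hx : c - ∫ t in (0 : ℝ)..x, B t = D x * (lam * ψ x) := by
    rw [hD]; field_simp [h0 x]
  rw [hdD]
  refine hq.congr_deriv ?_
  rw [hx, hB]
  simp only [hdD]
  have := h0 x
  field_simp
  ring

/-- A classical solution is a weak one. -/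
theorem IsProfile.of_classical {lam P : ℝ} {ψ dψ ddψ : ℝ → ℝ} (h1 : ∀ θ, HasDerivAt ψ (dψ θ) θ)
    (h2 : ∀ θ, HasDerivAt dψ (ddψ θ) θ)
    (heq : ∀ θ, 2 * (lam - 1) * P =
      -(lam - 1) * dψ θ ^ 2 + lam ^ 2 * ψ θ ^ 2 + lam * ddψ θ * ψ θ) :
    IsProfile lam P ψ := by
  have hd : deriv ψ = dψ := funext fun x => (h1 x).deriv
  have hc : Continuous ψ := continuous_iff_continuousAt.2 fun x => (h1 x).continuousAt
  have hdc : Continuous dψ := continuous_iff_continuousAt.2 fun x => (h2 x).continuousAt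
  have hC1 : ContDiff ℝ 1 ψ := by
    rw [contDiff_one_iff_deriv, hd]
    exact ⟨fun x => (h1 x).differentiableAt, hdc⟩
  refine ⟨fun a b => hC1.contDiffOn.absolutelyContinuousOnInterval, fun a b => ?_,
    fun φ hφ hφc => ?_⟩
  · rw [hd]
    obtain ⟨C, hC⟩ := isCompact_Icc.exists_bound_of_continuousOn (hdc.continuousOn (s := Icc a b))
    exact MemLp.of_bound hdc.aestronglyMeasurable C
      ((ae_restrict_mem measurableSet_Icc).mono fun x hx => hC x hx)
  · have hφ' : Continuous (deriv φ) := (hφ.continuous_deriv (by simp))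
    rw [hd]
    have hA : ∀ x, HasDerivAt (fun θ => lam * ψ θ * dψ θ)
        (lam * dψ x * dψ x + lam * ψ x * ddψ x) x := fun x =>
      ((h1 x).const_mul lam).mul (h2 x)
    have e' : ∀ x, lam * dψ x * dψ x + lam * ψ x * ddψ x
        = (2 * lam - 1) * dψ x ^ 2 - lam ^ 2 * ψ x ^ 2 + 2 * (lam - 1) * P := by
      intro x; rw [heq x]; ring
    have hA' : Continuous fun x => lam * dψ x * dψ x + lam * ψ x * ddψ x := by
      simp_rw [e']; fun_prop
    have i4 : Integrable φ := hφ.continuous.integrable_of_hasCompactSupport hφc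
    have i1 : Integrable fun x => lam * ψ x * dψ x * deriv φ x :=
      Continuous.integrable_of_hasCompactSupport (by fun_prop) (hφc.deriv.mul_left)
    have i2 : Integrable fun x => (lam * dψ x * dψ x + lam * ψ x * ddψ x) * φ x :=
      Continuous.integrable_of_hasCompactSupport (hA'.mul hφ.continuous) (hφc.mul_left)
    have i3 : Integrable fun x => lam * ψ x * dψ x * φ x :=
      Continuous.integrable_of_hasCompactSupport
        (((continuous_const.mul hc).mul hdc).mul hφ.continuous) (hφc.mul_left)
    have key := integral_mul_deriv_eq_deriv_mul_of_integrable
      (u := fun θ => lam * ψ θ * dψ θ) (v := φ) (v' := deriv φ) (fun x _ => hA x)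
      (fun x _ => (hφ.differentiable (by simp) x).hasDerivAt) i1 i2 i3
    have e : (fun θ => (-(2 * lam - 1) * dψ θ ^ 2 + lam ^ 2 * ψ θ ^ 2) * φ θ
          - lam * ψ θ * dψ θ * deriv φ θ)
          = fun θ => (2 * (lam - 1) * P * φ θ
            - (lam * dψ θ * dψ θ + lam * ψ θ * ddψ θ) * φ θ)
            - lam * ψ θ * dψ θ * deriv φ θ := by
        funext θ; rw [e']; ring
    have s1 : ∫ θ, (2 * (lam - 1) * P * φ θ
            - (lam * dψ θ * dψ θ + lam * ψ θ * ddψ θ) * φ θ)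
            - lam * ψ θ * dψ θ * deriv φ θ
        = (∫ θ, (2 * (lam - 1) * P * φ θ
            - (lam * dψ θ * dψ θ + lam * ψ θ * ddψ θ) * φ θ))
            - ∫ θ, lam * ψ θ * dψ θ * deriv φ θ :=
      integral_sub ((i4.const_mul _).sub i2) i1
    rw [e, s1, integral_sub (i4.const_mul _) i2,
      integral_const_mul, key]
    ring

/-! ### Positive solutions of autonomous second-order equations. -/

/-- `y` is a positive solution of `y'' = F(y)` on the real line, with derivative `dy`. -/
structure IsPosSolution (F y dy : ℝ → ℝ) : Prop where
  pos : ∀ t, 0 < y t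
  hasDerivAt : ∀ t, HasDerivAt y (dy t) t
  hasDerivAt' : ∀ t, HasDerivAt dy (F (y t)) t

namespace IsPosSolution

variable {F y dy z dz : ℝ → ℝ}

theorem continuous (h : IsPosSolution F y dy) : Continuous y :=
  continuous_iff_continuousAt.2 fun t => (h.hasDerivAt t).continuousAt

theorem unique (hF : ContDiffOn ℝ 1 F (Ioi 0)) (hy : IsPosSolution F y dy)
    (hz : IsPosSolution F z dz) {t₀ : ℝ} (h0 : y t₀ = z t₀) (h1 : dy t₀ = dz t₀) : y = z := by
  funext t
  obtain ⟨A, B, ht, ht₀⟩ : ∃ A B, t ∈ Ioo A B ∧ t₀ ∈ Ioo A B :=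
    ⟨min t t₀ - 1, max t t₀ + 1, by grind, by grind⟩
  -- `F` may be singular at `0`; on a compact time interval both solutions stay in some `[m, M]`
  -- with `m > 0`, where `F` is Lipschitz.
  obtain ⟨m, hm, M, hbd⟩ : ∃ m, 0 < m ∧ ∃ M, ∀ s ∈ Icc A B, y s ∈ Icc m M ∧ z s ∈ Icc m M := by
    have hne : (Icc A B).Nonempty := ⟨t, Ioo_subset_Icc_self ht⟩
    obtain ⟨a, -, ha⟩ := isCompact_Icc.exists_isMinOn hne hy.continuous.continuousOn
    obtain ⟨b, -, hb⟩ := isCompact_Icc.exists_isMaxOn hne hy.continuous.continuousOn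
    obtain ⟨c, -, hc⟩ := isCompact_Icc.exists_isMinOn hne hz.continuous.continuousOn
    obtain ⟨d, -, hd⟩ := isCompact_Icc.exists_isMaxOn hne hz.continuous.continuousOn
    refine ⟨min (y a) (z c), lt_min (hy.pos a) (hz.pos c), max (y b) (z d), fun s hs => ?_⟩
    exact ⟨⟨(min_le_left _ _).trans (ha hs), (hb hs).trans (le_max_left _ _)⟩,
      ⟨(min_le_right _ _).trans (hc hs), (hd hs).trans (le_max_right _ _)⟩⟩
  obtain ⟨K, hK⟩ := (hF.mono (show Icc m M ⊆ Ioi 0 from fun x hx => hm.trans_le hx.1)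
    ).exists_lipschitzOnWith (by decide) (convex_Icc m M) isCompact_Icc
  have hv : ∀ s ∈ Ioo A B, LipschitzOnWith (max 1 K) (fun p : ℝ × ℝ => (p.2, F p.1))
      (Icc m M ×ˢ univ) := by
    intro s _
    refine LipschitzOnWith.prodMk LipschitzWith.prod_snd.lipschitzOnWith ?_
    have := hK.comp (LipschitzWith.prod_fst.lipschitzOnWith (s := Icc m M ×ˢ (univ : Set ℝ)))
      (fun p hp => hp.1)
    rw [mul_one] at this
    exact this
  have := ODE_solution_unique_of_mem_Ioo (v := fun _ p => (p.2, F p.1))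
    (s := fun _ => Icc m M ×ˢ univ) hv ht₀
    (f := fun s => (y s, dy s)) (g := fun s => (z s, dz s))
    (fun s hs => ⟨(hy.hasDerivAt s).prodMk (hy.hasDerivAt' s),
      (hbd s (Ioo_subset_Icc_self hs)).1, mem_univ _⟩)
    (fun s hs => ⟨(hz.hasDerivAt s).prodMk (hz.hasDerivAt' s),
      (hbd s (Ioo_subset_Icc_self hs)).2, mem_univ _⟩)
    (by simp [h0, h1]) ht
  exact congrArg Prod.fst this

theorem comp_neg (h : IsPosSolution F y dy) (a : ℝ) :
    IsPosSolution F (fun t => y (a - t)) (fun t => -dy (a - t)) where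
  pos _ := h.pos _
  hasDerivAt t := by
    exact (h.hasDerivAt (a - t)).comp_const_sub a t
  hasDerivAt' t := by
    simpa using! ((h.hasDerivAt' (a - t)).comp_const_sub a t).neg

theorem comp_add (h : IsPosSolution F y dy) (a : ℝ) :
    IsPosSolution F (fun t => y (t + a)) (fun t => dy (t + a)) where
  pos _ := h.pos _
  hasDerivAt t := (h.hasDerivAt (t + a)).comp_add_const t a
  hasDerivAt' t := (h.hasDerivAt' (t + a)).comp_add_const t a

/-- Solutions are symmetric about their critical points. -/
theorem symm_of_critical (hF : ContDiffOn ℝ 1 F (Ioi 0)) (h : IsPosSolution F y dy) {a : ℝ}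
    (ha : dy a = 0) (t : ℝ) : y (2 * a - t) = y t :=
  congrFun (unique hF (h.comp_neg (2 * a)) h (t₀ := a) (by ring_nf)
    (by rw [show 2 * a - a = a by ring, ha, neg_zero])) t

theorem periodic_of_critical (hF : ContDiffOn ℝ 1 F (Ioi 0)) (h : IsPosSolution F y dy)
    {a b : ℝ} (ha : dy a = 0) (hb : dy b = 0) : Function.Periodic y (2 * (b - a)) := fun t => by
  rw [← h.symm_of_critical hF ha t, ← h.symm_of_critical hF hb]
  ring_nf

theorem deriv_periodic (h : IsPosSolution F y dy) {T : ℝ} (hT : Function.Periodic y T) :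
    Function.Periodic dy T := fun t => by
  have := (h.comp_add T).hasDerivAt t
  rw [show (fun t => y (t + T)) = y from funext hT] at this
  exact this.unique (h.hasDerivAt t)

theorem eq_const (hF : ContDiffOn ℝ 1 F (Ioi 0)) (h : IsPosSolution F y dy) {a : ℝ}
    (ha : dy a = 0) (hFa : F (y a) = 0) (t : ℝ) : y t = y a := by
  have hc : IsPosSolution F (fun _ => y a) (fun _ => 0) :=
    ⟨fun _ => h.pos a, fun t => hasDerivAt_const t _, fun t => by
      rw [hFa]; exact hasDerivAt_const t _⟩
  exact congrFun (unique hF h hc (t₀ := a) rfl ha) t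

/-- A solution that is constant on an interval sits at a zero of `F`, so uniqueness makes it
constant everywhere. This supplies the non-vanishing needed in the Sturm comparison. -/
theorem exists_deriv_ne_zero (hF : ContDiffOn ℝ 1 F (Ioi 0)) (h : IsPosSolution F y dy)
    (hnc : ¬ ∃ c, ∀ t, y t = c) {a b : ℝ} (hab : a < b) : ∃ c ∈ Ioo a b, dy c ≠ 0 := by
  by_contra! hcon
  have hm : (a + b) / 2 ∈ Ioo a b := ⟨by linarith, by linarith⟩
  have he : dy =ᶠ[nhds ((a + b) / 2)] fun _ => 0 :=
    Filter.eventually_of_mem (isOpen_Ioo.mem_nhds hm) hcon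
  have := (h.hasDerivAt' ((a + b) / 2)).unique
    ((hasDerivAt_const ((a + b) / 2) (0 : ℝ)).congr_of_eventuallyEq he)
  exact hnc ⟨_, h.eq_const hF (hcon _ hm) this⟩

end IsPosSolution

/-! ### Sturm comparison with `sin (w (t - a))`. -/

section Sturm

variable {v dv Q : ℝ → ℝ} {w a b : ℝ}

/-- The Wronskian of a solution of `v'' = -Q v` and of `sin (w (t - a))`. -/
theorem hasDerivAt_sturm_wronskian (hv : ∀ t, HasDerivAt v (dv t) t)
    (hdv : ∀ t, HasDerivAt dv (-Q t * v t) t) (w a t : ℝ) :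
    HasDerivAt (fun t => dv t * Real.sin (w * (t - a)) - w * v t * Real.cos (w * (t - a)))
      ((w ^ 2 - Q t) * v t * Real.sin (w * (t - a))) t := by
  have hl : HasDerivAt (fun t => w * (t - a)) w t := by
    simpa using ((hasDerivAt_id t).sub_const a).const_mul w
  refine (((hdv t).mul hl.sin).sub (((hv t).const_mul w).mul hl.cos)).congr_deriv ?_
  ring

theorem exists_zero_between {v : ℝ → ℝ} (hv : Continuous v) {c : ℝ} (ha : v a = 0) (hb : v b = 0)
    (hac : a < c) (hcb : c < b) (hc : v c ≠ 0) :
    ∃ a' b', a ≤ a' ∧ a' < c ∧ c < b' ∧ b' ≤ b ∧ v a' = 0 ∧ v b' = 0 ∧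
      ∀ t ∈ Ioo a' b', v t ≠ 0 := by
  have hcl : IsClosed {t | v t = 0} := isClosed_eq hv continuous_const
  obtain ⟨a', ⟨ha1, ha2⟩, ha3⟩ := (isCompact_Icc (a := a) (b := c)).inter_right hcl
    |>.exists_isGreatest ⟨a, ⟨le_rfl, hac.le⟩, ha⟩
  obtain ⟨b', ⟨hb1, hb2⟩, hb3⟩ := (isCompact_Icc (a := c) (b := b)).inter_right hcl
    |>.exists_isLeast ⟨b, ⟨hcb.le, le_rfl⟩, hb⟩
  have h1 : a' ≠ c := fun h => hc (h ▸ ha2)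
  have h2 : c ≠ b' := fun h => hc (h ▸ hb2)
  refine ⟨a', b', ha1.1, lt_of_le_of_ne ha1.2 h1, lt_of_le_of_ne hb1.1 h2, hb1.2, ha2, hb2,
    fun t ht h0 => ?_⟩
  rcases le_total t c with h | h
  · exact absurd (ha3 ⟨⟨ha1.1.trans ht.1.le, h⟩, h0⟩) (not_le.2 ht.1)
  · exact absurd (hb3 ⟨⟨h, ht.2.le.trans hb1.2⟩, h0⟩) (not_le.2 ht.2)

theorem pos_or_neg_of_ne_zero {v : ℝ → ℝ} (hv : Continuous v) (h : ∀ t ∈ Ioo a b, v t ≠ 0) :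
    (∀ t ∈ Ioo a b, 0 < v t) ∨ ∀ t ∈ Ioo a b, 0 < -v t := by
  by_contra! hcon
  obtain ⟨⟨s, hs, hs'⟩, t, ht, ht'⟩ := hcon
  have h0 : (0 : ℝ) ∈ v '' (Ioo a b) :=
    (isPreconnected_Ioo.image v hv.continuousOn).Icc_subset
      (mem_image_of_mem v hs) (mem_image_of_mem v ht) ⟨hs', by linarith⟩
  obtain ⟨r, hr, hr'⟩ := h0
  exact h r hr hr'

/-- Sturm comparison: a solution of `v'' = -Q v` with `Q > w ^ 2` that vanishes at `a` vanishes
again before `a + π / w`. -/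
theorem exists_zero_of_sturm (hw : 0 < w) (hv : ∀ t, HasDerivAt v (dv t) t)
    (hdv : ∀ t, HasDerivAt dv (-Q t * v t) t) (hQ : ∀ t, w ^ 2 < Q t) (ha : v a = 0) :
    ∃ b ∈ Ioo a (a + Real.pi / w), v b = 0 := by
  by_contra! hcon
  have hvc : Continuous v := continuous_iff_continuousAt.2 fun t => (hv t).continuousAt
  have hlt : a < a + Real.pi / w := by have := Real.pi_pos; simp; positivity
  have hπ : w * (a + Real.pi / w - a) = Real.pi := by field_simp; ring
  wlog hpos : ∀ t ∈ Ioo a (a + Real.pi / w), 0 < v t generalizing v dv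
  · refine this (v := fun t => -v t) (dv := fun t => -dv t) (fun t => (hv t).neg)
      (fun t => ?_) (by simp [ha]) (fun t ht => neg_ne_zero.2 (hcon t ht)) hvc.neg
      ((pos_or_neg_of_ne_zero hvc hcon).resolve_left hpos)
    simpa using! (hdv t).neg
  set W := fun t => dv t * Real.sin (w * (t - a)) - w * v t * Real.cos (w * (t - a)) with hW
  have hWd : ∀ t, HasDerivAt W ((w ^ 2 - Q t) * v t * Real.sin (w * (t - a))) t :=
    fun t => hasDerivAt_sturm_wronskian hv hdv w a t
  have hWc : Continuous W := continuous_iff_continuousAt.2 fun t => (hWd t).continuousAt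
  -- With `v > 0` inside, the Wronskian decreases strictly from `0`, yet at the right end it equals
  -- `w * v`, which is non-negative.
  have hanti : StrictAntiOn W (Icc a (a + Real.pi / w)) := by
    refine strictAntiOn_of_deriv_neg (convex_Icc _ _) hWc.continuousOn fun t ht => ?_
    rw [interior_Icc] at ht
    rw [(hWd t).deriv]
    have hs : 0 < Real.sin (w * (t - a)) := by
      refine Real.sin_pos_of_pos_of_lt_pi (mul_pos hw (by linarith [ht.1])) ?_
      rw [← hπ]
      exact mul_lt_mul_of_pos_left (by linarith [ht.2]) hw
    exact mul_neg_of_neg_of_pos (mul_neg_of_neg_of_pos (by linarith [hQ t]) (hpos t ht)) hs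
  have h1 := hanti ⟨le_rfl, hlt.le⟩ ⟨hlt.le, le_rfl⟩ hlt
  have h2 : 0 ≤ v (a + Real.pi / w) := by
    refine ge_of_tendsto ((hvc.tendsto (a + Real.pi / w)).mono_left
      (nhdsWithin_le_nhds (s := Iio (a + Real.pi / w)))) ?_
    filter_upwards [Ioo_mem_nhdsLT hlt] with t ht using (hpos t ht).le
  simp only [hW, hπ, sub_self, mul_zero, ha, Real.sin_zero, Real.sin_pi, Real.cos_pi] at h1
  have := mul_nonneg hw.le h2
  linarith

/-- Sturm comparison: two zeros of a solution of `v'' = -Q v` with `Q < w ^ 2`, between which the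
solution does not vanish identically, are more than `π / w` apart. -/
theorem pi_div_lt_of_sturm (hw : 0 < w) (hv : ∀ t, HasDerivAt v (dv t) t)
    (hdv : ∀ t, HasDerivAt dv (-Q t * v t) t) (hQ : ∀ t, Q t < w ^ 2) (ha : v a = 0) (hb : v b = 0)
    (hne : ∃ c ∈ Ioo a b, v c ≠ 0) : Real.pi / w < b - a := by
  by_contra! hle
  have hvc : Continuous v := continuous_iff_continuousAt.2 fun t => (hv t).continuousAt
  obtain ⟨c, ⟨hac, hcb⟩, hc⟩ := hne
  obtain ⟨a', b', ha', hac', hcb', hb', hva, hvb, hno⟩ := exists_zero_between hvc ha hb hac hcb hc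
  have hle' : w * (b' - a') ≤ Real.pi := by
    have := mul_le_mul_of_nonneg_left (show b' - a' ≤ Real.pi / w by linarith) hw.le
    rwa [mul_div_cancel₀ _ hw.ne'] at this
  have hlt : a' < b' := by linarith
  clear ha hb hc
  wlog hpos : ∀ t ∈ Ioo a' b', 0 < v t generalizing v dv
  · refine this (v := fun t => -v t) (dv := fun t => -dv t) (fun t => (hv t).neg)
      (fun t => ?_) hvc.neg (by simp [hva]) (by simp [hvb]) (fun t ht => neg_ne_zero.2 (hno t ht))
      ((pos_or_neg_of_ne_zero hvc hno).resolve_left hpos)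
    simpa using! (hdv t).neg
  set W := fun t => dv t * Real.sin (w * (t - a')) - w * v t * Real.cos (w * (t - a')) with hW
  have hWd : ∀ t, HasDerivAt W ((w ^ 2 - Q t) * v t * Real.sin (w * (t - a'))) t :=
    fun t => hasDerivAt_sturm_wronskian hv hdv w a' t
  have hWc : Continuous W := continuous_iff_continuousAt.2 fun t => (hWd t).continuousAt
  -- On this nodal interval the Wronskian increases strictly from `0`, yet at `b'` it is `dv b'`
  -- times a non-negative sine, and `dv b' ≤ 0` because `v` comes down to zero there.
  have hmono : StrictMonoOn W (Icc a' b') := by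
    refine strictMonoOn_of_deriv_pos (convex_Icc _ _) hWc.continuousOn fun t ht => ?_
    rw [interior_Icc] at ht
    rw [(hWd t).deriv]
    have hs : 0 < Real.sin (w * (t - a')) := by
      refine Real.sin_pos_of_pos_of_lt_pi (mul_pos hw (by linarith [ht.1])) ?_
      exact (mul_lt_mul_of_pos_left (by linarith [ht.2]) hw).trans_le hle'
    exact mul_pos (mul_pos (by linarith [hQ t]) (hpos t ht)) hs
  have h1 := hmono ⟨le_rfl, hlt.le⟩ ⟨hlt.le, le_rfl⟩ hlt
  have h2 : dv b' ≤ 0 := by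
    have hmin : ∀ᶠ t in nhdsWithin b' (Iio b'), slope v b' t ≤ 0 := by
      filter_upwards [Ioo_mem_nhdsLT hlt] with t ht
      rw [slope_def_field, hvb, sub_zero]
      exact div_nonpos_of_nonneg_of_nonpos (hpos t ht).le (by linarith [ht.2])
    exact le_of_tendsto ((hasDerivAt_iff_tendsto_slope.1 (hv b')).mono_left
      (nhdsWithin_mono b' fun t (ht : t ∈ Iio b') => ne_of_lt ht)) hmin
  have h3 : 0 ≤ Real.sin (w * (b' - a')) :=
    Real.sin_nonneg_of_nonneg_of_le_pi (mul_nonneg hw.le (by linarith)) hle'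
  simp only [hW, hvb, sub_self, mul_zero, hva, Real.sin_zero, zero_mul, sub_zero] at h1
  have := mul_nonpos_of_nonpos_of_nonneg h2 h3
  linarith

end Sturm

/-! ### Sign normalisation and the substitution `h = ψ ^ (1 / lam)`. -/

theorem contDiffOn_rpow_field (k e c : ℝ) :
    ContDiffOn ℝ 1 (fun x : ℝ => k * x ^ e - c * x) (Ioi 0) := by
  intro x hx
  have : ContDiffAt ℝ 1 (fun x : ℝ => x ^ e) x :=
    Real.contDiffAt_rpow_const_of_ne (ne_of_gt hx)
  exact ((contDiffAt_const.mul this).sub (contDiffAt_const.mul contDiffAt_id)).contDiffWithinAt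

theorem contDiffOn_emden (k e : ℝ) : ContDiffOn ℝ 1 (fun x : ℝ => k * x ^ e - x) (Ioi 0) := by
  simpa using contDiffOn_rpow_field k e 1

theorem IsProfile.neg {lam P : ℝ} {ψ : ℝ → ℝ} (h : IsProfile lam P ψ) :
    IsProfile lam P (fun θ => -ψ θ) := by
  have hd : deriv (fun θ => -ψ θ) = fun θ => -deriv ψ θ := by
    funext θ; exact deriv.fun_neg
  refine ⟨fun a b => (h.absCont a b).neg, fun a b => ?_, fun φ hφ hφc => ?_⟩
  · rw [hd]; exact (h.memLp_deriv a b).neg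
  · rw [hd, ← h.weak_eq φ hφ hφc]
    congr 1; funext θ; ring

theorem IsElliptic.exists_sign {lam : ℝ} {ψ : ℝ → ℝ} (h : IsElliptic lam ψ) :
    ∃ ε : ℝ, (ε = 1 ∨ ε = -1) ∧ ∃ P, IsProfile lam P (fun θ => ε * ψ θ) ∧ ∀ θ, 0 < ε * ψ θ := by
  obtain ⟨⟨P, hP⟩, h0⟩ := h
  have hc := hP.continuous
  rcases lt_or_gt_of_ne (h0 0) with h | h
  · refine ⟨-1, Or.inr rfl, P, by simpa using hP.neg, fun θ => ?_⟩
    by_contra hcon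
    obtain ⟨r, hr⟩ := mem_range_of_exists_le_of_exists_ge hc ⟨0, h.le⟩ ⟨θ, by linarith⟩
    exact h0 r hr
  · refine ⟨1, Or.inl rfl, P, by simpa using hP, fun θ => ?_⟩
    by_contra hcon
    obtain ⟨r, hr⟩ := mem_range_of_exists_le_of_exists_ge hc ⟨θ, by linarith⟩ ⟨0, h.le⟩
    exact h0 r hr

/-- If `ψ` is a positive profile, then `h = ψ ^ (1 / lam)` solves `h'' = k h ^ (1 - 2 lam) - h`. -/
theorem IsProfile.isPosSolution_rpow {lam P : ℝ} {ψ : ℝ → ℝ} (h : IsProfile lam P ψ)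
    (hlam : 0 < lam) (h0 : ∀ θ, 0 < ψ θ) :
    IsPosSolution (fun x => 2 * (lam - 1) * P / lam ^ 2 * x ^ (1 - 2 * lam) - x)
      (fun θ => ψ θ ^ (1 / lam)) (fun θ => deriv ψ θ * (1 / lam) * ψ θ ^ (1 / lam - 1)) := by
  obtain ⟨h1, h2⟩ := h.classical hlam.ne' fun θ => (h0 θ).ne'
  refine ⟨fun t => Real.rpow_pos_of_pos (h0 t) _, fun t => ?_, fun t => ?_⟩
  · exact (h1 t).hasDerivAt.rpow_const (Or.inl (h0 t).ne')
  · have hp := h0 t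
    have hd := ((h2 t).mul_const (1 / lam)).mul
      ((h1 t).hasDerivAt.rpow_const (p := 1 / lam - 1) (Or.inl hp.ne'))
    refine hd.congr_deriv ?_
    have e1 : (ψ t ^ (1 / lam)) ^ (1 - 2 * lam) = ψ t ^ (1 / lam) / ψ t ^ 2 := by
      rw [← Real.rpow_mul hp.le, show 1 / lam * (1 - 2 * lam) = 1 / lam - 2 by field_simp,
        Real.rpow_sub hp, Real.rpow_two]
    simp only [e1]
    rw [Real.rpow_sub_one hp.ne' (1 / lam - 1), Real.rpow_sub_one hp.ne' (1 / lam)]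
    field_simp
    ring

/-! ### Spacing of the critical points of `h`. -/

namespace IsPosSolution

theorem exists_critical {F y dy : ℝ → ℝ} (h : IsPosSolution F y dy) {a T : ℝ} (hT : 0 < T)
    (hper : Function.Periodic y T) : ∃ b ∈ Ioo a (a + T), dy b = 0 :=
  exists_hasDerivAt_eq_zero (by linarith) h.continuous.continuousOn (hper a).symm
    fun t _ => h.hasDerivAt t

/-- Otherwise the derivative would be strictly decreasing, which contradicts its periodicity. -/
theorem exists_nonneg_of_periodic {F y dy : ℝ → ℝ} (h : IsPosSolution F y dy) {T : ℝ}
    (hT : 0 < T) (hper : Function.Periodic y T) : ∃ t, 0 ≤ F (y t) := by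
  by_contra! hcon
  have hanti : StrictAnti dy := strictAnti_of_deriv_neg fun t => by
    rw [(h.hasDerivAt' t).deriv]; exact hcon t
  have h1 := hanti hT
  have h2 := h.deriv_periodic hper 0
  rw [zero_add] at h2
  linarith

variable {k lam : ℝ} {h dh : ℝ → ℝ}

theorem coeff_pos (hs : IsPosSolution (fun x => k * x ^ (1 - 2 * lam) - x) h dh) {T : ℝ}
    (hT : 0 < T) (hper : Function.Periodic h T) : 0 < k := by
  obtain ⟨t, ht⟩ := hs.exists_nonneg_of_periodic hT hper
  by_contra hcon
  have h1 := hs.pos t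
  have h2 : 0 < h t ^ (1 - 2 * lam) := Real.rpow_pos_of_pos h1 _
  have := mul_nonpos_of_nonpos_of_nonneg (not_lt.1 hcon) h2.le
  linarith

/-- The differentiated equation is linear in `dh`, with coefficient compared with `1`; the sign of
the difference is that of `2 * lam - 1`. -/
theorem hasDerivAt_emden (hs : IsPosSolution (fun x => k * x ^ (1 - 2 * lam) - x) h dh) (t : ℝ) :
    HasDerivAt (fun t => k * h t ^ (1 - 2 * lam) - h t)
      (-(1 - (1 - 2 * lam) * k * h t ^ (-2 * lam)) * dh t) t := by
  refine ((((hs.hasDerivAt t).rpow_const (Or.inl (hs.pos t).ne')).const_mul k).sub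
    (hs.hasDerivAt t)).congr_deriv ?_
  rw [show 1 - 2 * lam - 1 = -2 * lam by ring]
  ring

theorem hasDerivAt_mul_deriv (hs : IsPosSolution (fun x => k * x ^ (1 - 2 * lam) - x) h dh)
    (t : ℝ) : HasDerivAt (fun t => h t * dh t)
      (dh t * dh t + h t * (k * h t ^ (1 - 2 * lam) - h t)) t :=
  (hs.hasDerivAt t).mul (hs.hasDerivAt' t)

/-- The product `h * dh` has the same zeros as `dh` but solves a linear equation whose coefficient
is compared with `4`; the sign of the difference is that of `lam - 2`. -/
theorem hasDerivAt_mul_deriv' (hs : IsPosSolution (fun x => k * x ^ (1 - 2 * lam) - x) h dh)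
    (t : ℝ) : HasDerivAt (fun t => dh t * dh t + h t * (k * h t ^ (1 - 2 * lam) - h t))
      (-(4 - 2 * (2 - lam) * k * h t ^ (-2 * lam)) * (h t * dh t)) t := by
  refine (((hs.hasDerivAt' t).mul (hs.hasDerivAt' t)).add
    ((hs.hasDerivAt t).mul (hs.hasDerivAt_emden t))).congr_deriv ?_
  rw [show (1 : ℝ) - 2 * lam = -2 * lam + 1 by ring, Real.rpow_add_one (hs.pos t).ne']
  ring

/-- For `1 / 2 < lam` two successive critical points are less than `π` apart. -/
theorem exists_critical_lt_pi (hs : IsPosSolution (fun x => k * x ^ (1 - 2 * lam) - x) h dh)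
    (hk : 0 < k) (hlam : 1 / 2 < lam) {a : ℝ} (ha : dh a = 0) :
    ∃ b ∈ Ioo a (a + Real.pi), dh b = 0 := by
  have := exists_zero_of_sturm (w := 1) one_pos hs.hasDerivAt' hs.hasDerivAt_emden
    (fun t => ?_) ha
  · simpa using this
  · have h2 : 0 < h t ^ (-2 * lam) := Real.rpow_pos_of_pos (hs.pos t) _
    have := mul_pos (mul_pos (show 0 < 2 * lam - 1 by linarith) hk) h2
    linarith

/-- For `lam < 1 / 2` any two critical points are more than `π` apart. -/
theorem pi_lt_of_critical (hs : IsPosSolution (fun x => k * x ^ (1 - 2 * lam) - x) h dh)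
    (hk : 0 < k) (hlam : lam < 1 / 2) (hnc : ¬ ∃ c, ∀ t, h t = c) {a b : ℝ} (hab : a < b)
    (ha : dh a = 0) (hb : dh b = 0) : Real.pi < b - a := by
  have := pi_div_lt_of_sturm (w := 1) one_pos hs.hasDerivAt' hs.hasDerivAt_emden
    (fun t => ?_) ha hb (hs.exists_deriv_ne_zero (contDiffOn_emden _ _) hnc hab)
  · simpa using this
  · have h2 : 0 < h t ^ (-2 * lam) := Real.rpow_pos_of_pos (hs.pos t) _
    have := mul_pos (mul_pos (show 0 < 1 - 2 * lam by linarith) hk) h2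
    linarith

/-- For `2 < lam` two successive critical points are less than `π / 2` apart. -/
theorem exists_critical_lt_pi_div_two
    (hs : IsPosSolution (fun x => k * x ^ (1 - 2 * lam) - x) h dh)
    (hk : 0 < k) (hlam : 2 < lam) {a : ℝ} (ha : dh a = 0) :
    ∃ b ∈ Ioo a (a + Real.pi / 2), dh b = 0 := by
  obtain ⟨b, hb, hb0⟩ := exists_zero_of_sturm (w := 2) two_pos hs.hasDerivAt_mul_deriv
    hs.hasDerivAt_mul_deriv' (fun t => by
      have h2 : 0 < h t ^ (-2 * lam) := Real.rpow_pos_of_pos (hs.pos t) _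
      have := mul_pos (mul_pos (show 0 < lam - 2 by linarith) hk) h2
      linarith) (a := a) (by simp [ha])
  exact ⟨b, hb, (mul_eq_zero.1 hb0).resolve_left (hs.pos b).ne'⟩

/-- For `lam < 2` any two critical points are more than `π / 2` apart. -/
theorem pi_div_two_lt_of_critical
    (hs : IsPosSolution (fun x => k * x ^ (1 - 2 * lam) - x) h dh)
    (hk : 0 < k) (hlam : lam < 2) (hnc : ¬ ∃ c, ∀ t, h t = c) {a b : ℝ} (hab : a < b)
    (ha : dh a = 0) (hb : dh b = 0) : Real.pi / 2 < b - a := by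
  obtain ⟨c, hc, hc0⟩ := hs.exists_deriv_ne_zero (contDiffOn_emden _ _) hnc hab
  refine pi_div_lt_of_sturm (w := 2) two_pos hs.hasDerivAt_mul_deriv
    hs.hasDerivAt_mul_deriv' (fun t => ?_) (by simp [ha]) (by simp [hb])
    ⟨c, hc, mul_ne_zero (hs.pos c).ne' hc0⟩
  have h2 : 0 < h t ^ (-2 * lam) := Real.rpow_pos_of_pos (hs.pos t) _
  have := mul_pos (mul_pos (show 0 < 2 - lam by linarith) hk) h2
  linarith

/-- Rolle puts a critical point strictly inside a period between two others. Both gaps exceed `π`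
although they add up to `2π`. -/
theorem const_of_lt_half (hs : IsPosSolution (fun x => k * x ^ (1 - 2 * lam) - x) h dh)
    (hlam : lam < 1 / 2) (hper : Function.Periodic h (2 * Real.pi)) : ∃ c, ∀ t, h t = c := by
  by_contra hnc
  have hk := hs.coeff_pos Real.two_pi_pos hper
  obtain ⟨a, -, ha⟩ := hs.exists_critical (a := 0) Real.two_pi_pos hper
  obtain ⟨b, hb, hb0⟩ := hs.exists_critical (a := a) Real.two_pi_pos hper
  have ha' : dh (a + 2 * Real.pi) = 0 := by rw [hs.deriv_periodic hper, ha]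
  have h1 := hs.pi_lt_of_critical hk hlam hnc hb.1 ha hb0
  have h2 := hs.pi_lt_of_critical hk hlam hnc hb.2 hb0 ha'
  linarith

/-- A gap `b - a` between `π / 2` and `π` gives the period `2 (b - a)`, so the difference `2π - 2 (b
- a)` is a positive period below `π`. Rolle splits it into two gaps, each above `π / 2`. -/
theorem const_of_lt_two (hs : IsPosSolution (fun x => k * x ^ (1 - 2 * lam) - x) h dh)
    (hlam : 1 / 2 < lam) (hlam' : lam < 2) (hper : Function.Periodic h (2 * Real.pi)) :
    ∃ c, ∀ t, h t = c := by
  by_contra hnc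
  have hk := hs.coeff_pos Real.two_pi_pos hper
  obtain ⟨a, -, ha⟩ := hs.exists_critical (a := 0) Real.two_pi_pos hper
  obtain ⟨b, hb, hb0⟩ := hs.exists_critical_lt_pi hk hlam ha
  have h1 := hs.pi_div_two_lt_of_critical hk hlam' hnc hb.1 ha hb0
  have hper' : Function.Periodic h (2 * Real.pi - 2 * (b - a)) :=
    hper.sub_period (hs.periodic_of_critical (contDiffOn_emden _ _) ha hb0)
  have hT : 0 < 2 * Real.pi - 2 * (b - a) := by linarith [hb.2]
  obtain ⟨c, hc, hc0⟩ := hs.exists_critical (a := a) hT hper'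
  have ha' : dh (a + (2 * Real.pi - 2 * (b - a))) = 0 := by rw [hs.deriv_periodic hper', ha]
  have h2 := hs.pi_div_two_lt_of_critical hk hlam' hnc hc.1 ha hc0
  have h3 := hs.pi_div_two_lt_of_critical hk hlam' hnc hc.2 hc0 ha'
  linarith

end IsPosSolution

/-! ### Non-existence below `2`, and constant profiles. -/

theorem nontrivialElliptic_eq_empty {lam : ℝ} (hlam : 0 < lam) (hlam2 : lam < 2)
    (hhalf : lam ≠ 1 / 2) : nontrivialElliptic lam = ∅ := by
  rw [eq_empty_iff_forall_notMem]
  rintro ψ ⟨hell, hper, hnc⟩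
  obtain ⟨ε, hε, P, hP, hpos⟩ := hell.exists_sign
  have hs := hP.isPosSolution_rpow hlam hpos
  have hper' : Function.Periodic (fun θ => (ε * ψ θ) ^ (1 / lam)) (2 * Real.pi) := fun θ => by
    simp only [hper θ]
  obtain ⟨c, hc⟩ : ∃ c, ∀ t, (ε * ψ t) ^ (1 / lam) = c := by
    rcases lt_or_gt_of_ne hhalf with h | h
    · exact hs.const_of_lt_half h hper'
    · exact hs.const_of_lt_two h hlam2 hper'
  refine hnc ⟨ε * c ^ lam, fun θ => ?_⟩
  rw [← hc θ, ← Real.rpow_mul (hpos θ).le, one_div_mul_cancel hlam.ne', Real.rpow_one]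
  rcases hε with rfl | rfl <;> ring

theorem isElliptic_const {lam c : ℝ} (hlam1 : lam ≠ 1) (hc : c ≠ 0) :
    IsElliptic lam (fun _ => c) := by
  refine ⟨⟨lam ^ 2 * c ^ 2 / (2 * (lam - 1)), IsProfile.of_classical (dψ := fun _ => 0)
    (ddψ := fun _ => 0) (fun θ => hasDerivAt_const θ _) (fun θ => hasDerivAt_const θ _)
    fun θ => ?_⟩, fun _ => hc⟩
  have : lam - 1 ≠ 0 := sub_ne_zero.2 hlam1
  field_simp
  ring

/-! ### The vorticity form of the equation and the explicit cases `2` and `1 / 2`. -/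

/-- The solutions of `y'' = c - w ^ 2 y`. -/
theorem exists_eq_add_mul_cos {y dy : ℝ → ℝ} {w c : ℝ} (hw : 0 < w)
    (h1 : ∀ t, HasDerivAt y (dy t) t) (h2 : ∀ t, HasDerivAt dy (c - w ^ 2 * y t) t) :
    ∃ A t₀ : ℝ, ∀ t, y t = c / w ^ 2 + A * Real.cos (w * (t - t₀)) := by
  have hl : ∀ t, HasDerivAt (fun t => w * t) w t := fun t => by
    simpa using (hasDerivAt_id t).const_mul w
  -- The vector `(y - c / w ^ 2, dy / w)` rotates at speed `w`. Undoing the rotation gives a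
  -- constant vector, tested here against `(a, -b)`.
  have hder : ∀ (a b : ℝ), ∀ t, HasDerivAt (fun t => (y t - c / w ^ 2) * (a * Real.cos (w * t)
      - b * Real.sin (w * t)) + dy t / w * (-b * Real.cos (w * t) - a * Real.sin (w * t))) 0 t := by
    intro a b t
    refine ((((h1 t).sub_const (c / w ^ 2)).mul (((hl t).cos.const_mul a).sub
      ((hl t).sin.const_mul b))).add (((h2 t).div_const w).mul (((hl t).cos.const_mul (-b)).sub
      ((hl t).sin.const_mul a)))).congr_deriv ?_
    simp only [Pi.sub_apply]
    field_simp
    ring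
  have hconst : ∀ a b t, (y t - c / w ^ 2) * (a * Real.cos (w * t)
      - b * Real.sin (w * t)) + dy t / w * (-b * Real.cos (w * t) - a * Real.sin (w * t))
      = (y 0 - c / w ^ 2) * a - dy 0 / w * b := by
    intro a b t
    have := is_const_of_deriv_eq_zero (fun t => (hder a b t).differentiableAt)
      (fun t => (hder a b t).deriv) t 0
    simp only [mul_zero, Real.cos_zero, Real.sin_zero] at this
    rw [this]; ring
  -- Polar form of the initial data: the modulus is the amplitude and the argument is the phase.
  set z : ℂ := ⟨y 0 - c / w ^ 2, dy 0 / w⟩ with hz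
  refine ⟨‖z‖, z.arg / w, fun t => ?_⟩
  have hr : ‖z‖ * Real.cos z.arg = y 0 - c / w ^ 2 := Complex.norm_mul_cos_arg z
  have hi : ‖z‖ * Real.sin z.arg = dy 0 / w := Complex.norm_mul_sin_arg z
  rw [show w * (t - z.arg / w) = w * t - z.arg by field_simp, Real.cos_sub]
  have e := hconst (Real.cos (w * t)) (-Real.sin (w * t)) t
  have := Real.sin_sq_add_cos_sq (w * t)
  linear_combination e + Real.cos (w * t) * (-hr) + Real.sin (w * t) * (-hi)
    - (y t - c / w ^ 2) * this

/-- A positive profile solves `ψ'' = c ψ ^ (1 - 2 / lam) - lam ^ 2 ψ` for some constant `c`. -/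
theorem IsProfile.exists_isPosSolution {lam P : ℝ} {ψ : ℝ → ℝ} (h : IsProfile lam P ψ)
    (hlam : 0 < lam) (h0 : ∀ θ, 0 < ψ θ) :
    ∃ c, IsPosSolution (fun x => c * x ^ (1 - 2 / lam) - lam ^ 2 * x) ψ (deriv ψ) := by
  obtain ⟨h1, h2⟩ := h.classical hlam.ne' fun θ => (h0 θ).ne'
  -- The first factor is twice the angular part of the Bernoulli function; the power of `ψ` makes
  -- the product homogeneous of degree zero, and it is conserved.
  set C : ℝ → ℝ := fun θ =>
    (deriv ψ θ ^ 2 + lam ^ 2 * ψ θ ^ 2 + 2 * P) * ψ θ ^ (2 / lam - 2) with hC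
  have hCd : ∀ θ, HasDerivAt C 0 θ := by
    intro θ
    have hp := h0 θ
    have h1' := (h1 θ).hasDerivAt
    refine (((((h2 θ).pow 2).add ((h1'.pow 2).const_mul (lam ^ 2))).add_const (2 * P)).mul
      (h1'.rpow_const (p := 2 / lam - 2) (Or.inl hp.ne'))).congr_deriv ?_
    rw [Real.rpow_sub_one hp.ne' (2 / lam - 2)]
    simp only [Pi.add_apply, Pi.pow_apply]
    field_simp
    ring
  have hCc : ∀ θ, C θ = C 0 := fun θ =>
    is_const_of_deriv_eq_zero (fun t => (hCd t).differentiableAt) (fun t => (hCd t).deriv) θ 0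
  refine ⟨(lam - 1) / lam * C 0, h0, fun t => (h1 t).hasDerivAt, fun t => ?_⟩
  refine (h2 t).congr_deriv ?_
  have hp := h0 t
  rw [← hCc t, hC]
  have e : ψ t ^ (2 / lam - 2) * ψ t ^ (1 - 2 / lam) = (ψ t)⁻¹ := by
    rw [← Real.rpow_add hp, show 2 / lam - 2 + (1 - 2 / lam) = -1 by ring, Real.rpow_neg_one]
  have : (lam - 1) / lam * ((deriv ψ t ^ 2 + lam ^ 2 * ψ t ^ 2 + 2 * P) * ψ t ^ (2 / lam - 2))
      * ψ t ^ (1 - 2 / lam)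
      = (lam - 1) / lam * (deriv ψ t ^ 2 + lam ^ 2 * ψ t ^ 2 + 2 * P) * (ψ t)⁻¹ := by
    rw [← e]; ring
  rw [this]
  field_simp
  ring

/-- The energy of the semilinear equation is conserved, and it plays the role of `-2 * P`. -/
theorem IsPosSolution.isProfile {lam c : ℝ} {ψ dψ : ℝ → ℝ} (hlam : 0 < lam) (hlam1 : lam ≠ 1)
    (h : IsPosSolution (fun x => c * x ^ (1 - 2 / lam) - lam ^ 2 * x) ψ dψ) :
    ∃ P, IsProfile lam P ψ := by
  have hl : lam - 1 ≠ 0 := sub_ne_zero.2 hlam1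
  set C : ℝ → ℝ := fun θ => dψ θ ^ 2 + lam ^ 2 * ψ θ ^ 2
    - c * (lam / (lam - 1)) * ψ θ ^ (2 - 2 / lam) with hC
  have he : ∀ θ, ψ θ ^ (1 - 2 / lam) = ψ θ ^ (2 - 2 / lam) / ψ θ := fun θ => by
    rw [← Real.rpow_sub_one (h.pos θ).ne', show 2 - 2 / lam - 1 = 1 - 2 / lam by ring]
  have hCd : ∀ θ, HasDerivAt C 0 θ := by
    intro θ
    have hp := h.pos θ
    refine ((((h.hasDerivAt' θ).pow 2).add (((h.hasDerivAt θ).pow 2).const_mul (lam ^ 2))).sub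
      (((h.hasDerivAt θ).rpow_const (p := 2 - 2 / lam) (Or.inl hp.ne')).const_mul
        (c * (lam / (lam - 1))))).congr_deriv ?_
    rw [show 2 - 2 / lam - 1 = 1 - 2 / lam by ring, he]
    field_simp
    ring
  have hCc : ∀ θ, C θ = C 0 := fun θ =>
    is_const_of_deriv_eq_zero (fun t => (hCd t).differentiableAt) (fun t => (hCd t).deriv) θ 0
  refine ⟨-C 0 / 2, IsProfile.of_classical h.hasDerivAt h.hasDerivAt' fun θ => ?_⟩
  have hp := h.pos θ
  rw [← hCc θ, hC]
  simp only [he]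
  field_simp
  ring

theorem IsElliptic.of_pos {lam P ε : ℝ} {ψ : ℝ → ℝ} (hε : ε = 1 ∨ ε = -1)
    (h : IsProfile lam P (fun θ => ε * ψ θ)) (h0 : ∀ θ, 0 < ε * ψ θ) : IsElliptic lam ψ := by
  refine ⟨⟨P, ?_⟩, fun θ h' => by simpa [h'] using h0 θ⟩
  rcases hε with rfl | rfl
  · simpa using h
  · simpa using h.neg

theorem abs_lt_of_forall_cos_pos {a b w t₀ : ℝ} (hw : 0 < w)
    (h : ∀ t, 0 < a + b * Real.cos (w * (t - t₀))) : |b| < a := by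
  have h1 := h t₀
  have h2 := h (t₀ + Real.pi / w)
  rw [sub_self, mul_zero, Real.cos_zero] at h1
  rw [show w * (t₀ + Real.pi / w - t₀) = Real.pi by field_simp; ring, Real.cos_pi] at h2
  rw [abs_lt]
  constructor <;> linarith

theorem add_mul_cos_pos {a b : ℝ} (h : |b| < a) (x : ℝ) : 0 < a + b * Real.cos x := by
  have h1 : |b * Real.cos x| ≤ |b| := by
    rw [abs_mul]
    exact mul_le_of_le_one_right (abs_nonneg _) (Real.abs_cos_le_one x)
  have := neg_abs_le (b * Real.cos x)
  linarith

theorem isElliptic_two_iff {ψ : ℝ → ℝ} : IsElliptic 2 ψ ↔ ∃ γ₁ γ₂ θ₀ : ℝ, |γ₂| < |γ₁| ∧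
    ∀ θ, ψ θ = γ₁ + γ₂ * Real.cos (2 * (θ - θ₀)) := by
  constructor
  · intro h
    obtain ⟨ε, hε, P, hP, hpos⟩ := h.exists_sign
    obtain ⟨c, hs⟩ := hP.exists_isPosSolution two_pos hpos
    obtain ⟨A, t₀, hA⟩ := exists_eq_add_mul_cos two_pos hs.hasDerivAt (c := c) (fun t => by
      simpa using hs.hasDerivAt' t)
    have hlt := abs_lt_of_forall_cos_pos two_pos fun t => (hA t) ▸ hpos t
    have hε' : |ε| = 1 ∧ ε * ε = 1 := by rcases hε with rfl | rfl <;> norm_num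
    refine ⟨ε * (c / 2 ^ 2), ε * A, t₀, ?_, fun θ => ?_⟩
    · rw [abs_mul, abs_mul, hε'.1, one_mul, one_mul]
      exact hlt.trans_le (le_abs_self _)
    · linear_combination ε * hA θ - ψ θ * hε'.2
  · rintro ⟨γ₁, γ₂, θ₀, hlt, hψ⟩
    have hl : ∀ t, HasDerivAt (fun t => 2 * (t - θ₀)) 2 t := fun t => by
      simpa using ((hasDerivAt_id t).sub_const θ₀).const_mul 2
    have h1 : ∀ t, HasDerivAt ψ (γ₂ * (-Real.sin (2 * (t - θ₀)) * 2)) t := fun t => by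
      rw [show ψ = fun θ => γ₁ + γ₂ * Real.cos (2 * (θ - θ₀)) from funext hψ]
      exact ((hl t).cos.const_mul γ₂).const_add γ₁
    have h2 : ∀ t, HasDerivAt (fun t => γ₂ * (-Real.sin (2 * (t - θ₀)) * 2))
        (γ₂ * (-(Real.cos (2 * (t - θ₀)) * 2) * 2)) t := fun t =>
      (((hl t).sin.neg.mul_const 2).const_mul γ₂)
    refine ⟨⟨2 * (γ₁ ^ 2 - γ₂ ^ 2), IsProfile.of_classical h1 h2 fun θ => ?_⟩, fun θ => ?_⟩
    · rw [hψ]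
      linear_combination 4 * γ₂ ^ 2 * Real.sin_sq_add_cos_sq (2 * (θ - θ₀))
    · rw [hψ]
      intro h0
      have h3 : |γ₂ * Real.cos (2 * (θ - θ₀))| ≤ |γ₂| := by
        rw [abs_mul]
        exact mul_le_of_le_one_right (abs_nonneg _) (Real.abs_cos_le_one _)
      rw [show γ₁ = -(γ₂ * Real.cos (2 * (θ - θ₀))) by linarith, abs_neg] at hlt
      linarith

theorem isElliptic_half_iff {ψ : ℝ → ℝ} : IsElliptic (1 / 2) ψ ↔
    ∃ ε γ₁ γ₂ θ₀ : ℝ, (ε = 1 ∨ ε = -1) ∧ |γ₂| < γ₁ ∧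
        ∀ θ, ψ θ = ε * Real.sqrt (γ₁ + γ₂ * Real.cos (θ - θ₀)) := by
  constructor
  · intro h
    obtain ⟨ε, hε, P, hP, hpos⟩ := h.exists_sign
    have hs := hP.isPosSolution_rpow (by norm_num) hpos
    obtain ⟨A, t₀, hA⟩ := exists_eq_add_mul_cos one_pos hs.hasDerivAt
      (c := 2 * (1 / 2 - 1) * P / (1 / 2) ^ 2) (fun t => by
        have := hs.hasDerivAt' t
        rw [show (1 : ℝ) - 2 * (1 / 2) = 0 by norm_num, Real.rpow_zero, mul_one] at this
        rwa [one_pow, one_mul])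
    simp only [one_pow, div_one, one_mul] at hA
    have hlt := abs_lt_of_forall_cos_pos (w := 1) (b := A) (t₀ := t₀) one_pos fun t => by
      rw [one_mul, ← hA t]; exact hs.pos t
    have hε' : ε * ε = 1 := by rcases hε with rfl | rfl <;> norm_num
    refine ⟨ε, _, A, t₀, hε, hlt, fun θ => ?_⟩
    rw [← hA θ, show (1 : ℝ) / (1 / 2) = 2 by norm_num, Real.rpow_two,
      Real.sqrt_sq (hpos θ).le]
    linear_combination -ψ θ * hε'
  · rintro ⟨ε, γ₁, γ₂, θ₀, hε, hlt, hψ⟩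
    have hε' : ε * ε = 1 := by rcases hε with rfl | rfl <;> norm_num
    set g : ℝ → ℝ := fun θ => γ₁ + γ₂ * Real.cos (θ - θ₀) with hg
    have hgp : ∀ θ, 0 < g θ := fun θ => add_mul_cos_pos hlt _
    have hl : ∀ t, HasDerivAt (fun t => t - θ₀) 1 t := fun t => (hasDerivAt_id t).sub_const θ₀
    have h1 : ∀ t, HasDerivAt g (γ₂ * (-Real.sin (t - θ₀) * 1)) t := fun t =>
      ((hl t).cos.const_mul γ₂).const_add γ₁
    have h2 : ∀ t, HasDerivAt (fun t => γ₂ * (-Real.sin (t - θ₀) * 1))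
        (γ₂ * (-(Real.cos (t - θ₀) * 1) * 1)) t := fun t =>
      (((hl t).sin.neg.mul_const 1).const_mul γ₂)
    have hψp : ∀ θ, ε * ψ θ = Real.sqrt (g θ) := fun θ => by
      rw [hψ]; linear_combination Real.sqrt (g θ) * hε'
    refine IsElliptic.of_pos (P := -γ₁ / 4) hε ?_ fun θ => by
      rw [hψp]; exact Real.sqrt_pos.2 (hgp θ)
    rw [funext hψp]
    have hsq := fun t => (h1 t).sqrt (hgp t).ne'
    refine IsProfile.of_classical hsq (fun t => (h2 t).div ((hsq t).const_mul 2)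
      (mul_ne_zero two_ne_zero (Real.sqrt_pos.2 (hgp t)).ne')) fun θ => ?_
    have hs0 := Real.sqrt_pos.2 (hgp θ)
    have hs2 := Real.sq_sqrt (hgp θ).le
    set s := Real.sqrt (g θ)
    have hc : γ₂ * Real.cos (θ - θ₀) = s ^ 2 - γ₁ := by rw [hs2, hg]; ring
    field_simp
    linear_combination (8 * s ^ 2) * hc

theorem periodic_of_isElliptic_two {ψ : ℝ → ℝ} (h : IsElliptic 2 ψ) :
    Function.Periodic ψ (2 * Real.pi) := by
  obtain ⟨γ₁, γ₂, θ₀, -, hψ⟩ := isElliptic_two_iff.1 h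
  intro θ
  rw [hψ, hψ, show 2 * (θ + 2 * Real.pi - θ₀) = 2 * (θ - θ₀) + 2 * Real.pi + 2 * Real.pi by ring,
    Real.cos_add_two_pi, Real.cos_add_two_pi]

theorem periodic_of_isElliptic_half {ψ : ℝ → ℝ} (h : IsElliptic (1 / 2) ψ) :
    Function.Periodic ψ (2 * Real.pi) := by
  obtain ⟨ε, γ₁, γ₂, θ₀, -, -, hψ⟩ := isElliptic_half_iff.1 h
  intro θ
  rw [hψ, hψ, show θ + 2 * Real.pi - θ₀ = θ - θ₀ + 2 * Real.pi by ring, Real.cos_add_two_pi]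

/-! ### The potential of `u'' = u ^ q - u` and the period inequality. -/

namespace Emden

/-- The potential of `u'' = u ^ q - u`, normalised to vanish at the equilibrium `u = 1`. -/
noncomputable def pot (q u : ℝ) : ℝ := u ^ 2 / 2 - u ^ (1 + q) / (1 + q) + (1 - q) / (2 * (1 + q))

variable {q u : ℝ}

theorem hasDerivAt_pot (hq : 0 < q) (hu : 0 < u) : HasDerivAt (pot q) (u - u ^ q) u := by
  refine (((((hasDerivAt_id u).pow 2).div_const 2).sub (((hasDerivAt_id u).rpow_const
    (p := 1 + q) (Or.inl hu.ne')).div_const (1 + q))).add_const _).congr_deriv ?_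
  rw [show 1 + q - 1 = q by ring]
  simp only [id]
  field_simp
  norm_num
  ring

theorem hasDerivAt_dpot (hu : 0 < u) :
    HasDerivAt (fun u => u - u ^ q) (1 - q * u ^ (q - 1)) u := by
  refine ((hasDerivAt_id u).sub ((hasDerivAt_id u).rpow_const
    (p := q) (Or.inl hu.ne'))).congr_deriv ?_
  simp

theorem hasDerivAt_ddpot (hu : 0 < u) :
    HasDerivAt (fun u => 1 - q * u ^ (q - 1)) (q * (1 - q) * u ^ (q - 2)) u := by
  refine (((hasDerivAt_id u).rpow_const (p := q - 1) (Or.inl hu.ne')).const_mul q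
    |>.const_sub 1).congr_deriv ?_
  rw [show q - 1 - 1 = q - 2 by ring]
  simp only [id]
  ring

theorem pot_one (hq : 0 < q) : pot q 1 = 0 := by
  simp only [pot, Real.one_rpow]
  field_simp
  ring

theorem continuous_pot (hq : 0 < q) : Continuous (pot q) := by
  have : Continuous fun u : ℝ => u ^ (1 + q) :=
    Real.continuous_rpow_const (by linarith)
  unfold pot
  fun_prop

theorem dpot_pos (hq : q < 1) (hu : 1 < u) : 0 < u - u ^ q := by
  have := Real.rpow_lt_rpow_of_exponent_lt hu hq
  rw [Real.rpow_one] at this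
  linarith

theorem dpot_neg (hq : q < 1) (hu : 0 < u) (hu1 : u < 1) : u - u ^ q < 0 := by
  have := Real.rpow_lt_rpow_of_exponent_gt hu hu1 hq
  rw [Real.rpow_one] at this
  linarith

theorem strictMonoOn_pot (hq : 0 < q) (hq1 : q < 1) : StrictMonoOn (pot q) (Ici 1) := by
  refine strictMonoOn_of_deriv_pos (convex_Ici _) (continuous_pot hq).continuousOn fun t ht => ?_
  rw [interior_Ici] at ht
  rw [(hasDerivAt_pot hq (one_pos.trans ht)).deriv]
  exact dpot_pos hq1 ht

theorem strictAntiOn_pot (hq : 0 < q) (hq1 : q < 1) : StrictAntiOn (pot q) (Icc 0 1) := by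
  refine strictAntiOn_of_deriv_neg (convex_Icc _ _) (continuous_pot hq).continuousOn fun t ht => ?_
  rw [interior_Icc] at ht
  rw [(hasDerivAt_pot hq ht.1).deriv]
  exact dpot_neg hq1 ht.1 ht.2

theorem pot_pos (hq : 0 < q) (hq1 : q < 1) (hu : 0 ≤ u) (hu1 : u ≠ 1) : 0 < pot q u := by
  rw [← pot_one hq]
  rcases lt_or_gt_of_ne hu1 with h | h
  · exact strictAntiOn_pot hq hq1 ⟨hu, h.le⟩ ⟨zero_le_one, le_rfl⟩ h
  · exact strictMonoOn_pot hq hq1 (mem_Ici.2 le_rfl) (mem_Ici.2 h.le) h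

/-- Auxiliary function for the period inequality: the derivative of its left side is `V'''` times
this one. -/
noncomputable def aux (q u : ℝ) : ℝ :=
  u ^ (2 - q) * (u - u ^ q) ^ 2 * (1 - q * u ^ (q - 1)) / (1 - q) ^ 2 - 2 * pot q u

/-- The polynomial that governs the sign of the derivative of `aux`. -/
noncomputable def auxPoly (q s : ℝ) : ℝ :=
  (2 - q) * (s - 1) * (s - q) + 2 * (s - q) ^ 2 + q * (1 - q) * (s - 1)

theorem rpow_one_sub (hu : 0 < u) : u ^ (1 - q) = u / u ^ q := by
  rw [Real.rpow_sub hu, Real.rpow_one]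

theorem rpow_two_sub (hu : 0 < u) : u ^ (2 - q) = u ^ 2 / u ^ q := by
  rw [Real.rpow_sub hu, Real.rpow_two]

theorem rpow_sub_two (hu : 0 < u) : u ^ (q - 2) = u ^ q / u ^ 2 := by
  rw [Real.rpow_sub hu, Real.rpow_two]

theorem hasDerivAt_aux (hq : 0 < q) (hq1 : q < 1) (hu : 0 < u) :
    HasDerivAt (aux q) ((u - u ^ q) * (u ^ q * auxPoly q (u ^ (1 - q)) - 2 * (1 - q) ^ 2)
      / (1 - q) ^ 2) u := by
  have h1 : HasDerivAt (fun u : ℝ => u ^ (2 - q)) (1 * (2 - q) * u ^ (1 - q)) u := by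
    have := (hasDerivAt_id u).rpow_const (p := 2 - q) (Or.inl hu.ne')
    rwa [show 2 - q - 1 = 1 - q by ring] at this
  refine ((((h1.mul ((hasDerivAt_dpot hu).pow 2)).mul (hasDerivAt_ddpot hu)).div_const
    ((1 - q) ^ 2)).sub ((hasDerivAt_pot hq hu).const_mul 2)).congr_deriv ?_
  have hp : 0 < u ^ q := Real.rpow_pos_of_pos hu q
  have hq' : 1 - q ≠ 0 := by linarith
  simp only [Pi.mul_apply, Pi.pow_apply, auxPoly]
  rw [rpow_one_sub hu, rpow_two_sub hu, rpow_sub_two hu, Real.rpow_sub_one hu.ne']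
  field_simp
  ring

theorem aux_one (hq : 0 < q) : aux q 1 = 0 := by
  simp [aux, pot_one hq]

theorem continuousOn_aux (hq : 0 < q) (hq1 : q < 1) : ContinuousOn (aux q) (Ioi 0) :=
  fun _ hu => (hasDerivAt_aux hq hq1 hu).continuousAt.continuousWithinAt

theorem aux_pos (hq : 0 < q) (hq1 : q < 1) (hu : 1 < u) : 0 < aux q u := by
  have hm : StrictMonoOn (aux q) (Ici 1) := by
    refine strictMonoOn_of_deriv_pos (convex_Ici _)
      ((continuousOn_aux hq hq1).mono fun x hx => mem_Ioi.2 (one_pos.trans_le hx)) fun t ht => ?_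
    rw [interior_Ici] at ht
    have ht : 1 < t := ht
    rw [(hasDerivAt_aux hq hq1 (one_pos.trans ht)).deriv]
    have h1 := dpot_pos hq1 ht
    have hp : 1 < t ^ q := Real.one_lt_rpow ht hq
    have hs : 1 < t ^ (1 - q) := Real.one_lt_rpow ht (by linarith)
    set s := t ^ (1 - q)
    have hQ : 2 * (1 - q) ^ 2 < auxPoly q s := by
      have e : auxPoly q s = 2 * (1 - q) ^ 2
          + (s - 1) * ((2 - q) * (s - q) + 2 * ((s - q) + (1 - q)) + q * (1 - q)) := by
        unfold auxPoly; ring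
      have e1 := mul_pos (show 0 < 2 - q by linarith) (show 0 < s - q by linarith)
      have e2 := mul_pos hq (show 0 < 1 - q by linarith)
      have := mul_pos (show 0 < s - 1 by linarith)
        (show 0 < (2 - q) * (s - q) + 2 * ((s - q) + (1 - q)) + q * (1 - q) by linarith)
      linarith
    have hQ0 : 0 < auxPoly q s := lt_of_le_of_lt (by positivity) hQ
    have := lt_mul_of_one_lt_left hQ0 hp
    have hq' : 0 < (1 - q) ^ 2 := by have : 0 < 1 - q := by linarith
                                     positivity
    exact div_pos (mul_pos h1 (by linarith)) hq'
  rw [← aux_one hq]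
  exact hm (mem_Ici.2 le_rfl) (mem_Ici.2 hu.le) hu

theorem aux_neg (hq : 0 < q) (hq1 : q < 1) (hu : 0 < u) (hs : q ≤ u ^ (1 - q)) (hu1 : u < 1) :
    aux q u < 0 := by
  have hm : StrictMonoOn (aux q) (Icc u 1) := by
    refine strictMonoOn_of_deriv_pos (convex_Icc _ _)
      ((continuousOn_aux hq hq1).mono fun x hx => hu.trans_le hx.1) fun t ht => ?_
    rw [interior_Icc] at ht
    have ht0 : 0 < t := hu.trans ht.1
    rw [(hasDerivAt_aux hq hq1 ht0).deriv]
    have h1 := dpot_neg hq1 ht0 ht.2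
    have hp : t ^ q ≤ 1 := Real.rpow_le_one ht0.le ht.2.le hq.le
    have hp0 : 0 < t ^ q := Real.rpow_pos_of_pos ht0 q
    have hs1 : t ^ (1 - q) < 1 := Real.rpow_lt_one ht0.le ht.2 (by linarith)
    have hsq : q < t ^ (1 - q) :=
      hs.trans_lt (Real.rpow_lt_rpow hu.le ht.1 (by linarith))
    set s := t ^ (1 - q)
    have hQ : auxPoly q s < 2 * (1 - q) ^ 2 := by
      have e : auxPoly q s = 2 * (1 - q) ^ 2
          - (1 - s) * ((2 - q) * (s - q) + 2 * ((s - q) + (1 - q)) + q * (1 - q)) := by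
        unfold auxPoly; ring
      have e1 := mul_pos (show 0 < 2 - q by linarith) (show 0 < s - q by linarith)
      have e2 := mul_pos hq (show 0 < 1 - q by linarith)
      have := mul_pos (show 0 < 1 - s by linarith)
        (show 0 < (2 - q) * (s - q) + 2 * ((s - q) + (1 - q)) + q * (1 - q) by linarith)
      linarith
    have hq' : 0 < (1 - q) ^ 2 := by have : 0 < 1 - q := by linarith
                                     positivity
    have : t ^ q * auxPoly q s < 2 * (1 - q) ^ 2 := by
      rcases le_or_gt (auxPoly q s) 0 with h | h
      · have := mul_nonpos_of_nonneg_of_nonpos hp0.le h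
        linarith
      · exact (mul_le_of_le_one_left h.le hp).trans_lt hQ
    exact div_pos (mul_pos_of_neg_of_neg h1 (by linarith)) hq'
  rw [← aux_one hq]
  exact hm ⟨le_rfl, hu1.le⟩ ⟨hu1.le, le_rfl⟩ hu1

/-- The inequality behind the monotonicity of the period. -/
theorem period_inequality (hq : 0 < q) (hq1 : q < 1) (hu : 0 < u) (hu1 : u ≠ 1) :
    0 < (u - u ^ q) ^ 2 - 2 * pot q u * (1 - q * u ^ (q - 1))
      + q / (3 * (1 - q)) * (u - u ^ q) ^ 3 := by
  have hq' : 0 < 1 - q := by linarith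
  -- With `V = pot q` this is `V' ^ 2 - 2 V V'' + κ V' ^ 3`. The constant `κ = V'''(1) / (3 V''(1) ^
  -- 2)` cancels the cubic term at the equilibrium, where the other two terms already cancel to
  -- second order.
  set G : ℝ → ℝ := fun u => (u - u ^ q) ^ 2 - 2 * pot q u * (1 - q * u ^ (q - 1))
      + q / (3 * (1 - q)) * (u - u ^ q) ^ 3 with hG
  have hGd : ∀ t, 0 < t → HasDerivAt G (q * (1 - q) * t ^ (q - 2) * aux q t) t := by
    intro t ht
    refine ((((hasDerivAt_dpot ht).pow 2).sub (((hasDerivAt_pot hq ht).const_mul 2).mul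
      (hasDerivAt_ddpot ht))).add (((hasDerivAt_dpot ht).pow 3).const_mul
      (q / (3 * (1 - q))))).congr_deriv ?_
    have hp : 0 < t ^ q := Real.rpow_pos_of_pos ht q
    simp only [aux]
    rw [rpow_two_sub ht, rpow_sub_two ht, Real.rpow_sub_one ht.ne']
    field_simp
    ring
  have hG1 : G 1 = 0 := by simp [hG, pot_one hq]
  have hGc : ContinuousOn G (Ioi 0) := fun t ht => (hGd t ht).continuousAt.continuousWithinAt
  have hd3 : ∀ t, 0 < t → 0 < q * (1 - q) * t ^ (q - 2) := fun t ht =>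
    mul_pos (mul_pos hq hq') (Real.rpow_pos_of_pos ht _)
  rcases lt_or_gt_of_ne hu1 with h | h
  -- The dichotomy is the sign of `V''`. Where `V'' ≥ 0`, `aux` controls the monotonicity of `G` up
  -- to `1`. Where `V'' < 0`, the term `-2 V V''` helps, and Bernoulli's inequality gives `V' ≥ -(1
  -- - q)`, so that `1 + κ V' > 0`.
  · rcases le_or_gt q (u ^ (1 - q)) with hs | hs
    · have hm : StrictAntiOn G (Icc u 1) := by
        refine strictAntiOn_of_deriv_neg (convex_Icc _ _)
          (hGc.mono fun x hx => hu.trans_le hx.1) fun t ht => ?_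
        rw [interior_Icc] at ht
        have ht0 : 0 < t := hu.trans ht.1
        rw [(hGd t ht0).deriv]
        refine mul_neg_of_pos_of_neg (hd3 t ht0) (aux_neg hq hq1 ht0 (hs.trans ?_) ht.2)
        exact Real.rpow_le_rpow hu.le ht.1.le hq'.le
      have := hm ⟨le_rfl, h.le⟩ ⟨h.le, le_rfl⟩ h
      rwa [hG1] at this
    · have h1 := dpot_neg hq1 hu h
      have hp : 0 < u ^ q := Real.rpow_pos_of_pos hu q
      have h2 : 1 - q * u ^ (q - 1) ≤ 0 := by
        rw [rpow_one_sub hu, div_lt_iff₀ hp] at hs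
        rw [Real.rpow_sub_one hu.ne', sub_nonpos, mul_div_assoc', le_div_iff₀ hu, one_mul]
        exact hs.le
      have h3 := mul_nonneg (pot_pos hq hq1 hu.le hu1).le (neg_nonneg.2 h2)
      have h4 : u ^ q ≤ 1 + q * (u - 1) := by
        have := rpow_one_add_le_one_add_mul_self (s := u - 1) (by linarith) hq.le hq1.le
        rwa [add_sub_cancel] at this
      have h5 : -(1 - q) ≤ u - u ^ q := by
        have := mul_pos hq' hu
        linarith
      have h6 : 0 < 1 + q / (3 * (1 - q)) * (u - u ^ q) := by
        have h7 := mul_le_mul_of_nonneg_left h5 (show 0 ≤ q / (3 * (1 - q)) by positivity)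
        have h8 : q / (3 * (1 - q)) * -(1 - q) = -(q / 3) := by field_simp
        linarith
      have h9 := mul_pos (pow_pos (neg_pos.2 h1) 2) h6
      have e : (u - u ^ q) ^ 2 - 2 * pot q u * (1 - q * u ^ (q - 1))
          + q / (3 * (1 - q)) * (u - u ^ q) ^ 3
          = (-(u - u ^ q)) ^ 2 * (1 + q / (3 * (1 - q)) * (u - u ^ q))
            + 2 * (pot q u * -(1 - q * u ^ (q - 1))) := by ring
      rw [e]
      linarith
  · have hm : StrictMonoOn G (Ici 1) := by
      refine strictMonoOn_of_deriv_pos (convex_Ici _)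
        (hGc.mono fun x hx => mem_Ioi.2 (one_pos.trans_le hx)) fun t ht => ?_
      rw [interior_Ici] at ht
      have ht0 : 0 < t := one_pos.trans ht
      rw [(hGd t ht0).deriv]
      exact mul_pos (hd3 t ht0) (aux_pos hq hq1 ht)
    have := hm (mem_Ici.2 le_rfl) (mem_Ici.2 h.le) h
    rwa [hG1] at this

end Emden

/-! ### The coordinate `X` with `X ^ 2 = 2 V`, its inverse, and the time weight. -/

namespace Emden

/-- The coordinate `X` with `X ^ 2 = 2 V`, increasing through the equilibrium. -/
noncomputable def coord (q u : ℝ) : ℝ :=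
  if u < 1 then -√(2 * pot q u) else √(2 * pot q u)

/-- The derivative of `coord`. -/
noncomputable def dcoord (q u : ℝ) : ℝ :=
  if u = 1 then √(1 - q) else (u - u ^ q) / coord q u

/-- The lower end of the range of `coord` is `-amp q`. -/
noncomputable def amp (q : ℝ) : ℝ := √(2 * pot q 0)

variable {q u : ℝ}

theorem coord_sq (hq : 0 < q) (hq1 : q < 1) (hu : 0 ≤ u) : coord q u ^ 2 = 2 * pot q u := by
  have h : 0 ≤ pot q u := by
    rcases eq_or_ne u 1 with rfl | h
    · rw [pot_one hq]
    · exact (pot_pos hq hq1 hu h).le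
  unfold coord
  split_ifs
  · rw [neg_sq, Real.sq_sqrt (by linarith)]
  · rw [Real.sq_sqrt (by linarith)]

theorem coord_one (hq : 0 < q) : coord q 1 = 0 := by simp [coord, pot_one hq]

theorem coord_zero : coord q 0 = -amp q := by simp [coord, amp]

theorem amp_pos (hq : 0 < q) (hq1 : q < 1) : 0 < amp q :=
  Real.sqrt_pos.2 (by linarith [pot_pos hq hq1 le_rfl zero_ne_one])

theorem coord_pos (hq : 0 < q) (hq1 : q < 1) (hu : 1 < u) : 0 < coord q u := by
  rw [coord, if_neg (not_lt.2 hu.le)]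
  exact Real.sqrt_pos.2 (by linarith [pot_pos hq hq1 (by linarith) hu.ne'])

theorem coord_neg (hq : 0 < q) (hq1 : q < 1) (hu : 0 ≤ u) (hu1 : u < 1) : coord q u < 0 := by
  rw [coord, if_pos hu1]
  exact neg_neg_of_pos (Real.sqrt_pos.2 (by linarith [pot_pos hq hq1 hu hu1.ne]))

theorem continuous_coord (hq : 0 < q) : Continuous (coord q) := by
  have h := (continuous_const.mul (continuous_pot hq)).sqrt (f := fun u => 2 * pot q u)
  have : coord q = fun u => if u < 1 then -√(2 * pot q u) else √(2 * pot q u) := rfl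
  rw [this]
  refine Continuous.if (fun a ha => ?_) h.neg h
  have : a = 1 := by
    have h1 : a ∈ frontier (Iio (1 : ℝ)) := ha
    simpa [frontier_Iio] using h1
  rw [this, pot_one hq]; simp

theorem coord_ne_zero (hq : 0 < q) (hq1 : q < 1) (hu : 0 ≤ u) (hu1 : u ≠ 1) : coord q u ≠ 0 := by
  rcases lt_or_gt_of_ne hu1 with h | h
  · exact (coord_neg hq hq1 hu h).ne
  · exact (coord_pos hq hq1 h).ne'

theorem dcoord_pos (hq : 0 < q) (hq1 : q < 1) (hu : 0 < u) : 0 < dcoord q u := by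
  rcases lt_trichotomy u 1 with h | rfl | h
  · rw [dcoord, if_neg h.ne]
    exact div_pos_of_neg_of_neg (dpot_neg hq1 hu h) (coord_neg hq hq1 hu.le h)
  · rw [dcoord, if_pos rfl]
    exact Real.sqrt_pos.2 (by linarith)
  · rw [dcoord, if_neg h.ne']
    exact div_pos (dpot_pos hq1 h) (coord_pos hq hq1 h)

theorem hasDerivAt_coord_of_ne (hq : 0 < q) (hq1 : q < 1) (hu : 0 < u) (hu1 : u ≠ 1) :
    HasDerivAt (coord q) (dcoord q u) u := by
  have h := ((hasDerivAt_pot hq hu).const_mul 2).sqrt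
    (by have := pot_pos hq hq1 hu.le hu1; linarith)
  rw [dcoord, if_neg hu1]
  rcases lt_or_gt_of_ne hu1 with h' | h'
  · have e : coord q =ᶠ[nhds u] fun u => -√(2 * pot q u) := by
      filter_upwards [Iio_mem_nhds h'] with t ht using if_pos ht
    refine (h.neg.congr_of_eventuallyEq e).congr_deriv ?_
    rw [coord, if_pos h', mul_div_mul_left _ _ two_ne_zero, div_neg]
  · have e : coord q =ᶠ[nhds u] fun u => √(2 * pot q u) := by
      filter_upwards [Ioi_mem_nhds h'] with t ht using if_neg (not_lt.2 (le_of_lt ht))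
    refine (h.congr_of_eventuallyEq e).congr_deriv ?_
    rw [coord, if_neg (not_lt.2 h'.le), mul_div_mul_left _ _ two_ne_zero]

/-- The square of `dcoord` off the equilibrium is `V' ^ 2 / (2 V)`, which by l'Hôpital has the limit
`V''(1) = 1 - q`. -/
theorem continuousAt_dcoord_one (hq : 0 < q) (hq1 : q < 1) : ContinuousAt (dcoord q) 1 := by
  have hpos : ∀ᶠ t in nhdsWithin (1 : ℝ) {1}ᶜ, 0 < t :=
    eventually_nhdsWithin_of_eventually_nhds (Ioi_mem_nhds one_pos)
  have hne : ∀ᶠ t in nhdsWithin (1 : ℝ) {1}ᶜ, t ≠ 1 := eventually_mem_nhdsWithin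
  have hc1 : ContinuousAt (fun u : ℝ => u - u ^ q) 1 := (hasDerivAt_dpot one_pos).continuousAt
  have hlim : Filter.Tendsto (fun u => (u - u ^ q) ^ 2 / (2 * pot q u))
      (nhdsWithin (1 : ℝ) {1}ᶜ) (nhds (1 - q)) := by
    refine HasDerivAt.lhopital_zero_nhdsNE
      (f' := fun u => 2 * (u - u ^ q) * (1 - q * u ^ (q - 1))) (g' := fun u => 2 * (u - u ^ q))
      ?_ ?_ ?_ ?_ ?_ ?_
    · filter_upwards [hpos] with t ht
      refine ((hasDerivAt_dpot ht).pow 2).congr_deriv ?_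
      norm_num
    · filter_upwards [hpos] with t ht using (hasDerivAt_pot hq ht).const_mul 2
    · filter_upwards [hpos, hne] with t ht ht1
      rcases lt_or_gt_of_ne ht1 with h | h
      · have := dpot_neg hq1 ht h; linarith
      · have := dpot_pos hq1 h; linarith
    · have := hc1.tendsto.pow 2
      rw [show ((1 : ℝ) - 1 ^ q) ^ 2 = 0 by simp] at this
      exact this.mono_left nhdsWithin_le_nhds
    · have := ((continuous_pot hq).tendsto 1).const_mul 2
      rw [pot_one hq, mul_zero] at this
      exact this.mono_left nhdsWithin_le_nhds
    · have : Filter.Tendsto (fun u : ℝ => 1 - q * u ^ (q - 1)) (nhdsWithin (1 : ℝ) {1}ᶜ)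
          (nhds (1 - q)) := by
        have := (hasDerivAt_ddpot (q := q) one_pos).continuousAt.tendsto
        rw [Real.one_rpow, mul_one] at this
        exact this.mono_left nhdsWithin_le_nhds
      refine this.congr' ?_
      filter_upwards [hpos, hne] with t ht ht1
      have : t - t ^ q ≠ 0 := by
        rcases lt_or_gt_of_ne ht1 with h | h
        · exact (dpot_neg hq1 ht h).ne
        · exact (dpot_pos hq1 h).ne'
      field_simp
  have hs := hlim.sqrt
  rw [continuousAt_iff_punctured_nhds, show dcoord q 1 = √(1 - q) from if_pos rfl]
  refine hs.congr' ?_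
  filter_upwards [hpos, hne] with t ht ht1
  rw [← coord_sq hq hq1 ht.le, ← div_pow,
    show (t - t ^ q) / coord q t = dcoord q t from (if_neg ht1).symm]
  exact Real.sqrt_sq (dcoord_pos hq hq1 ht).le

theorem hasDerivAt_coord (hq : 0 < q) (hq1 : q < 1) (hu : 0 < u) :
    HasDerivAt (coord q) (dcoord q u) u := by
  rcases eq_or_ne u 1 with rfl | h
  -- The exponential carries the line onto `(0, ∞)`, because the removable-singularity criterion
  -- asks for a derivative at every other real point.
  · have hd : HasDerivAt (fun s => coord q (Real.exp s))
        (dcoord q (Real.exp 0) * Real.exp 0) 0 := by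
      refine hasDerivAt_of_hasDerivAt_of_ne (f := fun s => coord q (Real.exp s))
        (g := fun s => dcoord q (Real.exp s) * Real.exp s) (fun s hs => ?_) ?_ ?_
      · exact (hasDerivAt_coord_of_ne hq hq1 (Real.exp_pos s)
          (by simpa using hs)).comp s (Real.hasDerivAt_exp s)
      · exact ((continuous_coord hq).comp Real.continuous_exp).continuousAt
      · refine ContinuousAt.mul ?_ Real.continuous_exp.continuousAt
        refine ContinuousAt.comp (g := dcoord q) ?_ Real.continuous_exp.continuousAt
        rw [Real.exp_zero]
        exact continuousAt_dcoord_one hq hq1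
    rw [Real.exp_zero, mul_one, ← Real.log_one] at hd
    have h2 := hd.comp 1 (Real.hasDerivAt_log one_ne_zero)
    rw [inv_one, mul_one] at h2
    refine h2.congr_of_eventuallyEq ?_
    filter_upwards [Ioi_mem_nhds one_pos] with t ht
    simp [Real.exp_log ht]
  · exact hasDerivAt_coord_of_ne hq hq1 hu h

theorem continuousAt_dcoord (hq : 0 < q) (hq1 : q < 1) (hu : 0 < u) :
    ContinuousAt (dcoord q) u := by
  rcases eq_or_ne u 1 with rfl | h
  · exact continuousAt_dcoord_one hq hq1
  · have e : dcoord q =ᶠ[nhds u] fun u => (u - u ^ q) / coord q u := by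
      filter_upwards [isOpen_ne.mem_nhds h] with t ht using if_neg ht
    refine ContinuousAt.congr ?_ e.symm
    exact (hasDerivAt_dpot hu).continuousAt.div (continuous_coord hq).continuousAt
      (coord_ne_zero hq hq1 hu.le h)

theorem dcoord_mul_coord (hu : 0 < u) (hq : 0 < q) (hq1 : q < 1) :
    coord q u * dcoord q u = u - u ^ q := by
  rcases eq_or_ne u 1 with rfl | h
  · simp [coord_one hq]
  · rw [dcoord, if_neg h, mul_div_cancel₀ _ (coord_ne_zero hq hq1 hu.le h)]

theorem strictMonoOn_coord (hq : 0 < q) (hq1 : q < 1) : StrictMonoOn (coord q) (Ici 0) := by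
  refine strictMonoOn_of_deriv_pos (convex_Ici _) (continuous_coord hq).continuousOn fun t ht => ?_
  rw [interior_Ici] at ht
  rw [(hasDerivAt_coord hq hq1 ht).deriv]
  exact dcoord_pos hq hq1 ht

theorem exists_coord_eq (hq : 0 < q) (hq1 : q < 1) {y : ℝ} (hy : -amp q < y) :
    ∃ u, 0 < u ∧ coord q u = y := by
  have ha : 0 < (1 - q) / (1 + q) := div_pos (by linarith) (by linarith)
  set c := √((1 - q) / (1 + q)) with hc
  have hc0 : 0 < c := Real.sqrt_pos.2 ha
  -- Bernoulli's inequality gives `2 V(M) ≥ c ^ 2 (M - 1) ^ 2`, so this `M` lies beyond the level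
  -- `y`.
  set M := 1 + |y| / c with hM
  have hM1 : 1 ≤ M := by
    have : 0 ≤ |y| / c := by positivity
    linarith
  have hle : y ≤ coord q M := by
    rw [coord, if_neg (not_lt.2 hM1)]
    refine (le_abs_self y).trans (Real.le_sqrt_of_sq_le ?_)
    have h1 : |y| = c * (M - 1) := by rw [hM]; field_simp; ring
    rw [h1, mul_pow, Real.sq_sqrt ha.le]
    have h2 : M ^ q ≤ 1 + q * (M - 1) := by
      have := rpow_one_add_le_one_add_mul_self (s := M - 1) (by linarith) hq.le hq1.le
      rwa [add_sub_cancel] at this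
    have hM0 : 0 < M := by linarith
    have h3 := mul_le_mul_of_nonneg_left h2 hM0.le
    rw [pot, add_comm (1 : ℝ) q, Real.rpow_add_one hM0.ne']
    have hq' : 0 < q + 1 := by linarith
    field_simp
    linarith
  obtain ⟨u, hu, hu'⟩ := intermediate_value_Icc (show 0 ≤ M by linarith)
    (continuous_coord hq).continuousOn ⟨by rw [coord_zero]; exact hy.le, hle⟩
  refine ⟨u, lt_of_le_of_ne hu.1 ?_, hu'⟩
  rintro rfl
  rw [coord_zero] at hu'
  exact hy.ne hu'

open Classical in
/-- The inverse of `coord`. -/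
noncomputable def coordInv (q y : ℝ) : ℝ :=
  -- The default value `1` keeps the inverse, and hence the weight, positive for every `y`.
  if h : ∃ u, 0 < u ∧ coord q u = y then h.choose else 1

/-- The derivative of `coordInv`. -/
noncomputable def weight (q y : ℝ) : ℝ := (dcoord q (coordInv q y))⁻¹

variable {y : ℝ}

theorem coordInv_pos : 0 < coordInv q y := by
  unfold coordInv
  split_ifs with h
  · exact h.choose_spec.1
  · exact one_pos

theorem coord_coordInv (hq : 0 < q) (hq1 : q < 1) (hy : -amp q < y) :
    coord q (coordInv q y) = y := by
  have h := exists_coord_eq hq hq1 hy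
  rw [coordInv, dif_pos h]
  exact h.choose_spec.2

theorem neg_amp_lt_coord (hq : 0 < q) (hq1 : q < 1) (hu : 0 < u) : -amp q < coord q u := by
  rw [← coord_zero]
  exact strictMonoOn_coord hq hq1 (mem_Ici.2 le_rfl) (mem_Ici.2 hu.le) hu

theorem coordInv_coord (hq : 0 < q) (hq1 : q < 1) (hu : 0 < u) :
    coordInv q (coord q u) = u :=
  (strictMonoOn_coord hq hq1).injOn (mem_Ici.2 coordInv_pos.le) (mem_Ici.2 hu.le)
    (coord_coordInv hq hq1 (neg_amp_lt_coord hq hq1 hu))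

theorem strictMonoOn_coordInv (hq : 0 < q) (hq1 : q < 1) :
    StrictMonoOn (coordInv q) (Ioi (-amp q)) := by
  intro y hy z hz hyz
  rw [← (strictMonoOn_coord hq hq1).lt_iff_lt (mem_Ici.2 coordInv_pos.le)
    (mem_Ici.2 coordInv_pos.le), coord_coordInv hq hq1 hy, coord_coordInv hq hq1 hz]
  exact hyz

theorem coordInv_zero (hq : 0 < q) (hq1 : q < 1) : coordInv q 0 = 1 := by
  rw [← coord_one hq, coordInv_coord hq hq1 one_pos]

theorem hasDerivAt_coordInv (hq : 0 < q) (hq1 : q < 1) (hy : -amp q < y) :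
    HasDerivAt (coordInv q) (weight q y) y := by
  have hc : ContinuousAt (coordInv q) y := by
    refine (strictMonoOn_coordInv hq hq1).continuousAt_of_image_mem_nhds (Ioi_mem_nhds hy) ?_
    refine Filter.mem_of_superset (Ioi_mem_nhds (coordInv_pos (q := q) (y := y))) fun u hu => ?_
    exact ⟨coord q u, neg_amp_lt_coord hq hq1 hu, coordInv_coord hq hq1 hu⟩
  refine HasDerivAt.of_local_left_inverse hc (hasDerivAt_coord hq hq1 coordInv_pos)
    (dcoord_pos hq hq1 coordInv_pos).ne' ?_
  filter_upwards [Ioi_mem_nhds hy] with z hz using coord_coordInv hq hq1 hz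

theorem weight_pos (hq : 0 < q) (hq1 : q < 1) : 0 < weight q y :=
  inv_pos.2 (dcoord_pos hq hq1 coordInv_pos)

theorem continuousOn_weight (hq : 0 < q) (hq1 : q < 1) :
    ContinuousOn (weight q) (Ioi (-amp q)) := fun _ hy =>
  (((continuousAt_dcoord hq hq1 coordInv_pos).comp
    (hasDerivAt_coordInv hq hq1 hy).continuousAt).inv₀
    (dcoord_pos hq hq1 coordInv_pos).ne').continuousWithinAt

theorem weight_zero (hq : 0 < q) (hq1 : q < 1) : weight q 0 = (√(1 - q))⁻¹ := by
  rw [weight, coordInv_zero hq hq1, dcoord, if_pos rfl]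

theorem coordInv_ne_one (hq : 0 < q) (hq1 : q < 1) (hy : -amp q < y) (hy0 : y ≠ 0) :
    coordInv q y ≠ 1 := by
  intro h
  rw [← coord_coordInv hq hq1 hy, h, coord_one hq] at hy0
  exact hy0 rfl

theorem weight_eq (hq : 0 < q) (hq1 : q < 1) (hy : -amp q < y) (hy0 : y ≠ 0) :
    weight q y = y / (coordInv q y - coordInv q y ^ q) := by
  rw [weight, dcoord, if_neg (coordInv_ne_one hq hq1 hy hy0), inv_div, coord_coordInv hq hq1 hy]

theorem coordInv_dpot_ne_zero (hq : 0 < q) (hq1 : q < 1) (hy : -amp q < y) (hy0 : y ≠ 0) :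
    coordInv q y - coordInv q y ^ q ≠ 0 := by
  rcases lt_or_gt_of_ne (coordInv_ne_one hq hq1 hy hy0) with h | h
  · exact (dpot_neg hq1 coordInv_pos h).ne
  · exact (dpot_pos hq1 h).ne'

/-- The derivative of `weight` away from the equilibrium. -/
theorem hasDerivAt_weight (hq : 0 < q) (hq1 : q < 1) (hy : -amp q < y) (hy0 : y ≠ 0) :
    HasDerivAt (weight q) (((coordInv q y - coordInv q y ^ q) ^ 2
      - 2 * pot q (coordInv q y) * (1 - q * coordInv q y ^ (q - 1)))
        / (coordInv q y - coordInv q y ^ q) ^ 3) y := by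
  have hne := coordInv_dpot_ne_zero hq hq1 hy hy0
  have e : weight q =ᶠ[nhds y] fun y => y / (coordInv q y - coordInv q y ^ q) := by
    filter_upwards [Ioi_mem_nhds hy, isOpen_ne.mem_nhds hy0] with z hz hz0
      using weight_eq hq hq1 hz hz0
  have h1 : HasDerivAt (fun y => coordInv q y - coordInv q y ^ q)
      ((1 - q * coordInv q y ^ (q - 1)) * weight q y) y :=
    (hasDerivAt_dpot coordInv_pos).comp y (hasDerivAt_coordInv hq hq1 hy)
  refine (((hasDerivAt_id y).div h1 hne).congr_of_eventuallyEq e).congr_deriv ?_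
  have h2 := coord_sq hq hq1 (coordInv_pos (q := q) (y := y)).le
  rw [coord_coordInv hq hq1 hy] at h2
  rw [weight_eq hq hq1 hy hy0, ← h2]
  simp only [id]
  field_simp

theorem hasDerivAt_weight_sign (hq : 0 < q) (hq1 : q < 1) (hy : -amp q < y) (hy0 : y ≠ 0) :
    ∃ d, HasDerivAt (weight q) d y ∧ 0 < y * (d + q / (3 * (1 - q))) := by
  refine ⟨_, hasDerivAt_weight hq hq1 hy hy0, ?_⟩
  have hne := coordInv_dpot_ne_zero hq hq1 hy hy0
  have hG := period_inequality hq hq1 coordInv_pos (coordInv_ne_one hq hq1 hy hy0)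
  have h1 := weight_pos (y := y) hq hq1
  rw [weight_eq hq hq1 hy hy0] at h1
  set x := coordInv q y
  have hy' : 0 < y / (x - x ^ q) * ((x - x ^ q) ^ 2 - 2 * pot q x * (1 - q * x ^ (q - 1))
      + q / (3 * (1 - q)) * (x - x ^ q) ^ 3) / (x - x ^ q) ^ 2 :=
    div_pos (mul_pos h1 hG) (by positivity)
  -- The weight is `y / V'` and its derivative is `d = (V' ^ 2 - 2 V V'') / V' ^ 3`, so `y (d + κ)`
  -- is the weight times the period inequality over `V' ^ 2`.
  refine hy'.trans_eq ?_
  field_simp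

/-- The even part of `weight` increases with the amplitude. -/
theorem strictMonoOn_weight_add (hq : 0 < q) (hq1 : q < 1) :
    StrictMonoOn (fun y => weight q y + weight q (-y)) (Ico 0 (amp q)) := by
  have hA := amp_pos hq hq1
  refine strictMonoOn_of_deriv_pos (convex_Ico _ _) ?_ fun t ht => ?_
  · refine ((continuousOn_weight hq hq1).mono fun x hx => ?_).add
      ((continuousOn_weight hq hq1).comp continuous_neg.continuousOn fun x hx => ?_)
    · exact mem_Ioi.2 (by linarith [hx.1])
    · exact mem_Ioi.2 (by linarith [hx.2])
  · rw [interior_Ico] at ht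
    obtain ⟨d, hd, hd'⟩ := hasDerivAt_weight_sign hq hq1 (y := t) (by linarith [ht.1]) ht.1.ne'
    obtain ⟨e, he, he'⟩ := hasDerivAt_weight_sign hq hq1 (y := -t) (by linarith [ht.2])
      (neg_ne_zero.2 ht.1.ne')
    have h2 : HasDerivAt (fun y => weight q (-y)) (-e) t := by
      simpa using! he.comp t (hasDerivAt_neg t)
    rw [HasDerivAt.deriv (f := fun y => weight q y + weight q (-y)) (hd.add h2)]
    have := (mul_pos_iff_of_pos_left ht.1).1 hd'
    have h3 : 0 < t * (-(e + q / (3 * (1 - q)))) := by linarith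
    have := (mul_pos_iff_of_pos_left ht.1).1 h3
    -- The constant cancels: the slope exceeds `-q / (3 * (1 - q))` at `t` and lies below it at
    -- `-t`.
    linarith

end Emden

/-! ### The period function and the orbits in polar coordinates of the phase plane. -/

namespace Emden

variable {q r : ℝ}

/-- The period of the solution of `u'' = u ^ q - u` with amplitude `r`. -/
noncomputable def period (q r : ℝ) : ℝ := ∫ φ in (0 : ℝ)..(2 * Real.pi), weight q (r * Real.cos φ)

theorem abs_mul_cos_le (r φ : ℝ) : |r * Real.cos φ| ≤ |r| := by
  rw [abs_mul]
  exact mul_le_of_le_one_right (abs_nonneg _) (Real.abs_cos_le_one φ)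

theorem neg_amp_lt_mul_cos (hr : |r| < amp q) (φ : ℝ) : -amp q < r * Real.cos φ := by
  have := (abs_le.1 (abs_mul_cos_le r φ)).1
  linarith

theorem continuous_weight_cos (hq : 0 < q) (hq1 : q < 1) (hr : |r| < amp q) :
    Continuous fun φ => weight q (r * Real.cos φ) :=
  (continuousOn_weight hq hq1).comp_continuous (by fun_prop) fun φ => neg_amp_lt_mul_cos hr φ

theorem periodic_weight_cos : Function.Periodic (fun φ => weight q (r * Real.cos φ))
    (2 * Real.pi) := fun φ => by simp only [Real.cos_add_two_pi]

/-- Shifting the angle by `π` changes the sign of the cosine. -/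
theorem period_neg : period q (-r) = period q r := by
  have h := (periodic_weight_cos (q := q) (r := r)).intervalIntegral_add_eq Real.pi 0
  have h2 := intervalIntegral.integral_comp_add_right (a := 0) (b := 2 * Real.pi)
    (fun φ => weight q (r * Real.cos φ)) Real.pi
  simp only [Real.cos_add_pi, zero_add] at h2 h
  rw [period, period, ← h, add_comm Real.pi, ← h2]
  congr 1; funext φ; congr 1; ring

/-- Averaging over `r` and `-r` leaves only the even part of the weight, which is the part known to
be monotone. -/
theorem two_mul_period (hq : 0 < q) (hq1 : q < 1) (hr : |r| < amp q) :
    2 * period q r = ∫ φ in (0 : ℝ)..(2 * Real.pi),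
      (weight q |r * Real.cos φ| + weight q (-|r * Real.cos φ|)) := by
  have h1 := (continuous_weight_cos hq hq1 hr).intervalIntegrable (μ := volume) 0 (2 * Real.pi)
  have h2 := (continuous_weight_cos (r := -r) hq hq1 (by rwa [abs_neg])).intervalIntegrable
    (μ := volume) 0 (2 * Real.pi)
  have h3 := intervalIntegral.integral_add h1 h2
  have h4 : 2 * period q r = period q r + period q (-r) := by rw [period_neg]; ring
  rw [h4, period, period, ← h3]
  congr 1; funext φ
  rcases abs_cases (r * Real.cos φ) with ⟨h, -⟩ | ⟨h, -⟩
  · rw [h, neg_mul]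
  · rw [h, neg_mul, neg_neg, add_comm]

theorem strictMonoOn_period (hq : 0 < q) (hq1 : q < 1) :
    StrictMonoOn (period q) (Ico 0 (amp q)) := by
  intro r hr s hs hrs
  have hr' : |r| < amp q := by rw [abs_of_nonneg hr.1]; exact hr.2
  have hs' : |s| < amp q := by rw [abs_of_nonneg hs.1]; exact hs.2
  have hm := strictMonoOn_weight_add hq hq1
  have hc : ∀ r, |r| < amp q → Continuous fun φ =>
      weight q |r * Real.cos φ| + weight q (-|r * Real.cos φ|) := fun r hr =>
    ((continuousOn_weight hq hq1).comp_continuous (by fun_prop) fun φ => by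
      have := abs_nonneg (r * Real.cos φ)
      have := amp_pos hq hq1
      exact mem_Ioi.2 (by linarith)).add
    ((continuousOn_weight hq hq1).comp_continuous (by fun_prop) fun φ => by
      have := abs_mul_cos_le r φ
      exact mem_Ioi.2 (by linarith))
  have hmem : ∀ r, |r| < amp q → ∀ φ, |r * Real.cos φ| ∈ Ico 0 (amp q) := fun r hr φ =>
    ⟨abs_nonneg _, (abs_mul_cos_le r φ).trans_lt hr⟩
  have key : 2 * period q r < 2 * period q s := by
    rw [two_mul_period hq hq1 hr', two_mul_period hq hq1 hs']
    refine intervalIntegral.integral_lt_integral_of_continuousOn_of_le_of_exists_lt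
      Real.two_pi_pos (hc r hr').continuousOn (hc s hs').continuousOn (fun φ _ => ?_)
      ⟨0, ⟨le_rfl, Real.two_pi_pos.le⟩, ?_⟩
    · refine hm.monotoneOn (hmem r hr' φ) (hmem s hs' φ) ?_
      rw [abs_mul, abs_mul, abs_of_nonneg hr.1, abs_of_nonneg hs.1]
      exact mul_le_mul_of_nonneg_right hrs.le (abs_nonneg _)
    · refine hm (hmem r hr' 0) (hmem s hs' 0) ?_
      rw [Real.cos_zero, mul_one, mul_one, abs_of_nonneg hr.1, abs_of_nonneg hs.1]
      exact hrs
  linarith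

theorem period_zero (hq : 0 < q) (hq1 : q < 1) : period q 0 = 2 * Real.pi / √(1 - q) := by
  simp [period, weight_zero hq hq1, div_eq_mul_inv]

theorem continuousOn_period (hq : 0 < q) (hq1 : q < 1) {c : ℝ} (hcA : c < amp q) :
    ContinuousOn (period q) (Icc 0 c) := by
  -- Truncation at `-c` makes the integrand continuous everywhere and does not change it for
  -- amplitudes up to `c`.
  have h1 : Continuous fun y => weight q (max (-c) y) :=
    (continuousOn_weight hq hq1).comp_continuous (by fun_prop) fun y =>
      mem_Ioi.2 ((neg_lt_neg hcA).trans_le (le_max_left _ _))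
  have h2 : Continuous fun r => ∫ φ in (0 : ℝ)..(2 * Real.pi),
      weight q (max (-c) (r * Real.cos φ)) :=
    intervalIntegral.continuous_parametric_intervalIntegral_of_continuous'
      (f := fun r φ => weight q (max (-c) (r * Real.cos φ)))
      (h1.comp (g := fun y => weight q (max (-c) y)) (f := fun p : ℝ × ℝ => p.1 * Real.cos p.2)
        (by fun_prop)) _ _
  refine h2.continuousOn.congr fun r hr => ?_
  rw [period]
  congr 1; funext φ
  rw [max_eq_right]
  have := (abs_le.1 (abs_mul_cos_le r φ)).1
  rw [abs_of_nonneg hr.1] at this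
  linarith [hr.2]

theorem period_pos (hq : 0 < q) (hq1 : q < 1) (hr : |r| < amp q) : 0 < period q r :=
  intervalIntegral.intervalIntegral_pos_of_pos_on
    ((continuous_weight_cos hq hq1 hr).intervalIntegrable _ _) (fun _ _ => weight_pos hq hq1)
    Real.two_pi_pos

/-- The time as a function of the angle in the phase plane. -/
noncomputable def time (q r φ : ℝ) : ℝ := ∫ s in (0 : ℝ)..φ, weight q (r * Real.cos s)

theorem hasDerivAt_time (hq : 0 < q) (hq1 : q < 1) (hr : |r| < amp q) (φ : ℝ) :
    HasDerivAt (time q r) (weight q (r * Real.cos φ)) φ :=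
  ((continuous_weight_cos hq hq1 hr).integral_hasStrictDerivAt 0 φ).hasDerivAt

theorem time_add_zsmul (hq : 0 < q) (hq1 : q < 1) (hr : |r| < amp q) (φ : ℝ) (n : ℤ) :
    time q r (φ + n * (2 * Real.pi)) = time q r φ + n * period q r := by
  have hi : ∀ a b, IntervalIntegrable (fun φ => weight q (r * Real.cos φ)) volume a b :=
    fun a b => (continuous_weight_cos hq hq1 hr).intervalIntegrable a b
  have h := (periodic_weight_cos (q := q) (r := r)).intervalIntegral_add_zsmul_eq n φ hi
  rw [zsmul_eq_mul, zsmul_eq_mul] at h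
  rw [time, time, period, ← intervalIntegral.integral_add_adjacent_intervals (hi 0 φ) (hi φ _), h]
  congr 2
  exact (periodic_weight_cos (q := q) (r := r)).intervalIntegral_add_eq φ 0 |>.trans (by simp)

theorem strictMono_time (hq : 0 < q) (hq1 : q < 1) (hr : |r| < amp q) : StrictMono (time q r) :=
  strictMono_of_deriv_pos fun φ => by
    rw [(hasDerivAt_time hq hq1 hr φ).deriv]; exact weight_pos hq hq1

theorem surjective_time (hq : 0 < q) (hq1 : q < 1) (hr : |r| < amp q) :
    Function.Surjective (time q r) := by
  have hc : Continuous (time q r) :=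
    continuous_iff_continuousAt.2 fun φ => (hasDerivAt_time hq hq1 hr φ).continuousAt
  exact hc.surjective
    ((periodic_weight_cos (q := q) (r := r)).tendsto_atTop_intervalIntegral_of_pos
      (period_pos hq hq1 hr) Real.two_pi_pos)
    ((periodic_weight_cos (q := q) (r := r)).tendsto_atBot_intervalIntegral_of_pos
      (period_pos hq hq1 hr) Real.two_pi_pos)

/-- The angle in the phase plane as a function of time. -/
noncomputable def angle (q r : ℝ) : ℝ → ℝ := Function.invFun (time q r)

theorem time_angle (hq : 0 < q) (hq1 : q < 1) (hr : |r| < amp q) (t : ℝ) :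
    time q r (angle q r t) = t :=
  Function.rightInverse_invFun (surjective_time hq hq1 hr) t

theorem angle_time (hq : 0 < q) (hq1 : q < 1) (hr : |r| < amp q) (φ : ℝ) :
    angle q r (time q r φ) = φ :=
  Function.leftInverse_invFun (strictMono_time hq hq1 hr).injective φ

theorem hasDerivAt_angle (hq : 0 < q) (hq1 : q < 1) (hr : |r| < amp q) (t : ℝ) :
    HasDerivAt (angle q r) (weight q (r * Real.cos (angle q r t)))⁻¹ t := by
  have hm : StrictMono (angle q r) := fun s t hst => by
    rw [← (strictMono_time hq hq1 hr).lt_iff_lt, time_angle hq hq1 hr, time_angle hq hq1 hr]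
    exact hst
  have hc : Continuous (angle q r) := hm.monotone.continuous_of_surjective fun φ =>
    ⟨time q r φ, angle_time hq hq1 hr φ⟩
  exact HasDerivAt.of_local_left_inverse hc.continuousAt (hasDerivAt_time hq hq1 hr _)
    (weight_pos hq hq1).ne' (Filter.Eventually.of_forall fun s => time_angle hq hq1 hr s)

/-- The solution of `u'' = u ^ q - u` with amplitude `r` and a maximum at the origin. -/
noncomputable def sol (q r t : ℝ) : ℝ := coordInv q (r * Real.cos (angle q r t))

/-- The derivative of `sol`. -/
noncomputable def dsol (q r t : ℝ) : ℝ := -(r * Real.sin (angle q r t))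

/-- The energy curve is the circle `X = r cos φ`, `u' = -r sin φ`. The angle runs at speed `1 /
weight`, which is exactly what makes `dsol` the derivative of `sol`. -/
theorem isPosSolution_sol (hq : 0 < q) (hq1 : q < 1) (hr : |r| < amp q) :
    IsPosSolution (fun x => 1 * x ^ q - x) (sol q r) (dsol q r) := by
  refine ⟨fun t => coordInv_pos, fun t => ?_, fun t => ?_⟩
  · have h1 := (hasDerivAt_coordInv hq hq1 (neg_amp_lt_mul_cos hr (angle q r t)))
    refine (h1.comp t ((hasDerivAt_angle hq hq1 hr t).cos.const_mul r)).congr_deriv ?_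
    have := (weight_pos (y := r * Real.cos (angle q r t)) hq hq1).ne'
    rw [dsol]
    field_simp
  · refine (((hasDerivAt_angle hq hq1 hr t).sin.const_mul r).neg).congr_deriv ?_
    have h2 := dcoord_mul_coord (coordInv_pos (q := q) (y := r * Real.cos (angle q r t))) hq hq1
    rw [coord_coordInv hq hq1 (neg_amp_lt_mul_cos hr _)] at h2
    rw [weight, inv_inv, sol]
    linarith

theorem time_zero : time q r 0 = 0 := by simp [time]

theorem angle_zero (hq : 0 < q) (hq1 : q < 1) (hr : |r| < amp q) : angle q r 0 = 0 := by
  have := angle_time hq hq1 hr 0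
  rwa [time_zero] at this

theorem sol_zero (hq : 0 < q) (hq1 : q < 1) (hr : |r| < amp q) : sol q r 0 = coordInv q r := by
  rw [sol, angle_zero hq hq1 hr, Real.cos_zero, mul_one]

theorem dsol_zero (hq : 0 < q) (hq1 : q < 1) (hr : |r| < amp q) : dsol q r 0 = 0 := by
  rw [dsol, angle_zero hq hq1 hr, Real.sin_zero, mul_zero, neg_zero]

theorem angle_add_zsmul (hq : 0 < q) (hq1 : q < 1) (hr : |r| < amp q) (t : ℝ) (n : ℤ) :
    angle q r (t + n * period q r) = angle q r t + n * (2 * Real.pi) := by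
  apply (strictMono_time hq hq1 hr).injective
  rw [time_angle hq hq1 hr, time_add_zsmul hq hq1 hr, time_angle hq hq1 hr]

/-- The periods of `sol q r` are exactly the integer multiples of `period q r`. -/
theorem periodic_sol_iff (hq : 0 < q) (hq1 : q < 1) (hr : 0 < r) (hrA : r < amp q) {τ : ℝ} :
    Function.Periodic (sol q r) τ ↔ ∃ n : ℤ, τ = n * period q r := by
  have hr' : |r| < amp q := by rwa [abs_of_pos hr]
  constructor
  · intro h
    have h0 := h 0
    rw [zero_add, sol_zero hq hq1 hr', sol] at h0
    have h1 := (strictMonoOn_coordInv hq hq1).injOn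
      (mem_Ioi.2 (neg_amp_lt_mul_cos hr' (angle q r τ)))
      (mem_Ioi.2 (by linarith [amp_pos hq hq1])) h0
    have h2 : Real.cos (angle q r τ) = 1 := by
      have : r * Real.cos (angle q r τ) = r * 1 := by rw [h1, mul_one]
      exact mul_left_cancel₀ hr.ne' this
    obtain ⟨n, hn⟩ := (Real.cos_eq_one_iff _).1 h2
    refine ⟨n, ?_⟩
    rw [← time_angle hq hq1 hr' τ, ← hn, ← zero_add ((n : ℝ) * (2 * Real.pi)),
      time_add_zsmul hq hq1 hr', time_zero, zero_add]
  · rintro ⟨n, rfl⟩ t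
    rw [sol, angle_add_zsmul hq hq1 hr', sol, Real.cos_add_int_mul_two_pi]

/-- Reflection of the angle about `π` shows that the orbit reaches its minimum after exactly half
the period. -/
theorem sol_half_period (hq : 0 < q) (hq1 : q < 1) (hr : |r| < amp q) :
    sol q r (period q r / 2) = coordInv q (-r) ∧ dsol q r (period q r / 2) = 0 := by
  have h1 : period q r = time q r Real.pi + time q r Real.pi := by
    have hi : ∀ a b, IntervalIntegrable (fun φ => weight q (r * Real.cos φ)) volume a b :=
      fun a b => (continuous_weight_cos hq hq1 hr).intervalIntegrable a b
    rw [period, ← intervalIntegral.integral_add_adjacent_intervals (hi 0 Real.pi) (hi Real.pi _)]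
    congr 1
    have h2 := intervalIntegral.integral_comp_sub_left (a := 0) (b := Real.pi)
      (fun φ => weight q (r * Real.cos φ)) (2 * Real.pi)
    simp only [Real.cos_two_pi_sub, sub_zero] at h2
    rw [show 2 * Real.pi - Real.pi = Real.pi by ring] at h2
    exact h2.symm
  have h2 : angle q r (period q r / 2) = Real.pi := by
    rw [h1, add_self_div_two, angle_time hq hq1 hr]
  rw [sol, dsol, h2]
  simp

theorem not_const_sol (hq : 0 < q) (hq1 : q < 1) (hr : 0 < r) (hrA : r < amp q) :
    ¬ ∃ c, ∀ t, sol q r t = c := by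
  have hr' : |r| < amp q := by rwa [abs_of_pos hr]
  rintro ⟨c, hc⟩
  have hp := period_pos hq hq1 hr'
  obtain ⟨n, hn⟩ := (periodic_sol_iff hq hq1 hr hrA (τ := period q r / 2)).1
    (fun t => by rw [hc, hc])
  have h1 : (2 * n : ℝ) = 1 := by
    have : (2 * n : ℝ) * period q r = 1 * period q r := by linarith
    exact mul_right_cancel₀ hp.ne' this
  have h2 : 2 * n = 1 := by exact_mod_cast h1
  omega

end Emden

/-! ### Scaling, extrema, and a lower bound for `h`. -/

namespace IsPosSolution

variable {F G y dy : ℝ → ℝ}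

theorem scale (h : IsPosSolution F y dy) {b s : ℝ} (hb : 0 < b)
    (hG : ∀ x, 0 < x → b * s ^ 2 * F x = G (b * x)) :
    IsPosSolution G (fun t => b * y (s * t)) (fun t => b * (s * dy (s * t))) := by
  have hl : ∀ t, HasDerivAt (fun t => s * t) s t := fun t => by
    simpa using (hasDerivAt_id t).const_mul s
  refine ⟨fun t => mul_pos hb (h.pos _), fun t => ?_, fun t => ?_⟩
  · refine (((h.hasDerivAt (s * t)).comp t (hl t)).const_mul b).congr_deriv ?_
    ring
  · refine ((((h.hasDerivAt' (s * t)).comp t (hl t)).const_mul s).const_mul b).congr_deriv ?_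
    rw [← hG _ (h.pos _)]
    ring

theorem exists_forall_le (h : IsPosSolution F y dy) {T : ℝ} (hT : 0 < T)
    (hper : Function.Periodic y T) : ∃ a, (∀ t, y t ≤ y a) ∧ dy a = 0 := by
  obtain ⟨a, -, ha⟩ := isCompact_Icc.exists_isMaxOn (nonempty_Icc.2 hT.le) h.continuous.continuousOn
  have hmax : ∀ t, y t ≤ y a := fun t => by
    obtain ⟨s, hs, hst⟩ := hper.exists_mem_Ico₀ hT t
    rw [hst]
    exact ha (Ico_subset_Icc_self hs)
  exact ⟨a, hmax, IsLocalMax.hasDerivAt_eq_zero (Filter.Eventually.of_forall hmax) (h.hasDerivAt a)⟩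

theorem exists_forall_ge (h : IsPosSolution F y dy) {T : ℝ} (hT : 0 < T)
    (hper : Function.Periodic y T) : ∃ a, (∀ t, y a ≤ y t) ∧ dy a = 0 := by
  obtain ⟨a, -, ha⟩ := isCompact_Icc.exists_isMinOn (nonempty_Icc.2 hT.le) h.continuous.continuousOn
  have hmin : ∀ t, y a ≤ y t := fun t => by
    obtain ⟨s, hs, hst⟩ := hper.exists_mem_Ico₀ hT t
    rw [hst]
    exact ha (Ico_subset_Icc_self hs)
  exact ⟨a, hmin, IsLocalMin.hasDerivAt_eq_zero (Filter.Eventually.of_forall hmin) (h.hasDerivAt a)⟩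

/-- Variation of constants: `h θ - h 0 cos θ` is the integral of the positive forcing `k h ^ (1 - 2
lam)` against `sin (θ - t)`, which is non-negative for `θ ≤ π`. -/
theorem mul_cos_le {k lam : ℝ} {h dh : ℝ → ℝ}
    (hs : IsPosSolution (fun x => k * x ^ (1 - 2 * lam) - x) h dh) (hk : 0 < k) (h0 : dh 0 = 0)
    {θ : ℝ} (hθ : 0 ≤ θ) (hθ' : θ ≤ Real.pi) : h 0 * Real.cos θ ≤ h θ := by
  have hl : ∀ t, HasDerivAt (fun t => θ - t) (-1) t := fun t => (hasDerivAt_id t).const_sub θ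
  have hd : ∀ t, HasDerivAt (fun t => dh t * Real.sin (θ - t) + h t * Real.cos (θ - t))
      (k * h t ^ (1 - 2 * lam) * Real.sin (θ - t)) t := fun t => by
    refine (((hs.hasDerivAt' t).mul (hl t).sin).add
      ((hs.hasDerivAt t).mul (hl t).cos)).congr_deriv ?_
    ring
  have hm : MonotoneOn (fun t => dh t * Real.sin (θ - t) + h t * Real.cos (θ - t)) (Icc 0 θ) := by
    refine monotoneOn_of_deriv_nonneg (convex_Icc _ _)
      (fun t _ => (hd t).continuousAt.continuousWithinAt)
      (fun t _ => (hd t).differentiableAt.differentiableWithinAt) fun t ht => ?_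
    rw [interior_Icc] at ht
    rw [(hd t).deriv]
    exact mul_nonneg (mul_pos hk (Real.rpow_pos_of_pos (hs.pos t) _)).le
      (Real.sin_nonneg_of_nonneg_of_le_pi (by linarith [ht.2]) (by linarith [ht.1]))
  simpa [h0] using hm ⟨le_rfl, hθ⟩ ⟨hθ, le_rfl⟩ hθ

end IsPosSolution

/-! ### Classification of the periodic orbits and the range of the period. -/

namespace Emden

variable {q r lam : ℝ}

/-- Every non-constant periodic positive solution of `u'' = u ^ q - u` is a translate of some
`sol q r`. -/
theorem exists_eq_sol (hq : 0 < q) (hq1 : q < 1) {u du : ℝ → ℝ}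
    (h : IsPosSolution (fun x => 1 * x ^ q - x) u du) {T : ℝ} (hT : 0 < T)
    (hper : Function.Periodic u T) (hnc : ¬ ∃ c, ∀ t, u t = c) :
    ∃ r a, 0 < r ∧ r < amp q ∧ ∀ t, u (t + a) = sol q r t := by
  have hE : ∀ t, HasDerivAt (fun t => du t ^ 2 / 2 + pot q (u t)) 0 t := fun t => by
    refine ((((h.hasDerivAt' t).pow 2).div_const 2).add
      ((hasDerivAt_pot hq (h.pos t)).comp t (h.hasDerivAt t))).congr_deriv ?_
    norm_num
    ring
  obtain ⟨a, hmax, ha⟩ := h.exists_forall_le hT hper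
  obtain ⟨b, hmin, hb⟩ := h.exists_forall_ge hT hper
  -- Energy conservation puts the maximum and the minimum on the same level of the potential, on
  -- opposite sides of `1`. Their coordinates are therefore opposite, which bounds the amplitude by
  -- `amp q`.
  have hEab : pot q (u a) = pot q (u b) := by
    have := is_const_of_deriv_eq_zero (fun t => (hE t).differentiableAt) (fun t => (hE t).deriv) a b
    simpa [ha, hb] using this
  have hlt : u b < u a := by
    by_contra hcon
    exact hnc ⟨u a, fun t => le_antisymm (hmax t) ((not_lt.1 hcon).trans (hmin t))⟩
  have hb1 : u b < 1 := by
    by_contra hcon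
    have hcon := not_lt.1 hcon
    exact (strictMonoOn_pot hq hq1 (mem_Ici.2 hcon) (mem_Ici.2 (hcon.trans hlt.le)) hlt).ne hEab.symm
  have ha1 : 1 < u a := by
    by_contra hcon
    have hcon := not_lt.1 hcon
    exact (strictAntiOn_pot hq hq1 ⟨(h.pos b).le, hb1.le⟩ ⟨(h.pos a).le, hcon⟩ hlt).ne hEab
  have hr : 0 < coord q (u a) := coord_pos hq hq1 ha1
  have hrA : coord q (u a) < amp q := by
    have h1 := neg_amp_lt_coord hq hq1 (h.pos b)
    have h2 : coord q (u b) = -coord q (u a) := by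
      rw [coord, if_pos hb1, coord, if_neg (not_lt.2 ha1.le), hEab]
    linarith
  have hr' : |coord q (u a)| < amp q := by rwa [abs_of_pos hr]
  refine ⟨coord q (u a), a, hr, hrA, fun t => ?_⟩
  refine congrFun (IsPosSolution.unique (contDiffOn_emden 1 q) (h.comp_add a)
    (isPosSolution_sol hq hq1 hr') (t₀ := 0) ?_ ?_) t
  · rw [sol_zero hq hq1 hr', coordInv_coord hq hq1 (h.pos a), zero_add]
  · rw [dsol_zero hq hq1 hr', zero_add, ha]

theorem exponent_mem (hlam : 2 < lam) : 0 < 1 - 2 / lam ∧ 1 - 2 / lam < 1 := by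
  have h1 : 2 / lam < 1 := (div_lt_one (by linarith)).2 hlam
  have h2 : 0 < 2 / lam := div_pos two_pos (by linarith)
  constructor <;> linarith

theorem isPosSolution_profile (hlam : 2 < lam) (hr : |r| < amp (1 - 2 / lam)) :
    IsPosSolution (fun x => lam ^ 2 * x ^ (1 - 2 / lam) - lam ^ 2 * x)
      (fun θ => sol (1 - 2 / lam) r (lam * θ)) (fun θ => lam * dsol (1 - 2 / lam) r (lam * θ)) := by
  obtain ⟨hq, hq1⟩ := exponent_mem hlam
  simpa using (isPosSolution_sol hq hq1 hr).scale (b := 1) (s := lam)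
    (G := fun x => lam ^ 2 * x ^ (1 - 2 / lam) - lam ^ 2 * x) one_pos (fun x _ => by
      simp only [one_mul]; ring)

/-- The solution `h = ψ ^ (1 / lam)` for the profile `ψ θ = sol q r (lam θ)`. -/
theorem exists_isPosSolution_root (hlam : 2 < lam) (hr : 0 < r) (hrA : r < amp (1 - 2 / lam)) :
    ∃ k dh, 0 < k ∧ IsPosSolution (fun x => k * x ^ (1 - 2 * lam) - x)
      (fun θ => sol (1 - 2 / lam) r (lam * θ) ^ (1 / lam)) dh ∧
      ∀ θ, dsol (1 - 2 / lam) r (lam * θ) = 0 → dh θ = 0 := by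
  obtain ⟨hq, hq1⟩ := exponent_mem hlam
  have hr' : |r| < amp (1 - 2 / lam) := by rwa [abs_of_pos hr]
  have hs := isPosSolution_profile hlam hr'
  obtain ⟨P, hP⟩ := hs.isProfile (by linarith) (by linarith)
  have hh := hP.isPosSolution_rpow (by linarith) hs.pos
  have hT := period_pos hq hq1 hr'
  refine ⟨_, _, hh.coeff_pos (T := period (1 - 2 / lam) r / lam) (div_pos hT (by linarith))
    fun θ => ?_, hh, fun θ hθ => ?_⟩
  · have h1 := (periodic_sol_iff hq hq1 hr hrA).2 ⟨1, by rw [Int.cast_one, one_mul]⟩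
    have h2 : lam * (θ + period (1 - 2 / lam) r / lam) = lam * θ + period (1 - 2 / lam) r := by
      have : lam ≠ 0 := by linarith
      field_simp
    simp only [h2, h1 (lam * θ)]
  · rw [(hs.hasDerivAt θ).deriv, hθ]
    simp

/-- A critical point `b < π / 2` of `h` makes `2 b lam` a period of the orbit, hence a positive
integer multiple of the minimal one. -/
theorem period_lt (hlam : 2 < lam) (hr : 0 < r) (hrA : r < amp (1 - 2 / lam)) :
    period (1 - 2 / lam) r < lam * Real.pi := by
  obtain ⟨hq, hq1⟩ := exponent_mem hlam
  have hl0 : 0 < lam := by linarith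
  have hr' : |r| < amp (1 - 2 / lam) := by rwa [abs_of_pos hr]
  obtain ⟨k, dh, hk, hh, hd⟩ := exists_isPosSolution_root hlam hr hrA
  have h0 : dh 0 = 0 := hd 0 (by rw [mul_zero, dsol_zero hq hq1 hr'])
  obtain ⟨b, hb, hb0⟩ := hh.exists_critical_lt_pi_div_two hk hlam h0
  have hper := hh.periodic_of_critical (contDiffOn_emden _ _) h0 hb0
  have hper' : Function.Periodic (sol (1 - 2 / lam) r) (2 * b * lam) := fun t => by
    have h1 := congrArg (· ^ lam) (hper (t / lam))
    have hp := fun t => (isPosSolution_sol hq hq1 hr').pos t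
    simp only [← Real.rpow_mul (hp _).le, one_div_mul_cancel hl0.ne', Real.rpow_one] at h1
    rw [show t + 2 * b * lam = lam * (t / lam + 2 * (b - 0)) by field_simp; ring, h1]
    congr 1; field_simp
  obtain ⟨n, hn⟩ := (periodic_sol_iff hq hq1 hr hrA).1 hper'
  have hT := period_pos hq hq1 hr'
  have hpos : 0 < 2 * b * lam := by have := hb.1; positivity
  have hn0 : (0 : ℝ) < n := by
    rw [hn] at hpos
    exact pos_of_mul_pos_left hpos hT.le
  have hn1 : (1 : ℝ) ≤ n := by
    have : 0 < n := by exact_mod_cast hn0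
    exact_mod_cast this
  have h1 := le_mul_of_one_le_left hT.le hn1
  rw [← hn] at h1
  have h2 := mul_lt_mul_of_pos_right hb.2 hl0
  linarith

/-- A root `h` starting at a maximum of at least `1` stays above `cos θ` up to `π`, so reaching a
value below `1 / 2` takes longer than `π / 3`. The bound `2π / 3` on the profile period is enough,
since only `n ≥ 3` matters. -/
theorem exists_lt_period (hlam : 2 < lam) :
    ∃ r, 0 < r ∧ r < amp (1 - 2 / lam) ∧ 2 * Real.pi * lam / 3 < period (1 - 2 / lam) r := by
  obtain ⟨hq, hq1⟩ := exponent_mem hlam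
  have hl0 : 0 < lam := by linarith
  -- The minimum of the orbit, chosen so that `ε ^ (1 / lam) < 1 / 2`.
  set ε : ℝ := (1 / 2) ^ lam / 2 with hε
  have hp0 : (0 : ℝ) < (1 / 2) ^ lam := by positivity
  have hε0 : 0 < ε := by positivity
  have hε1 : ε < 1 := by
    have : (1 / 2 : ℝ) ^ lam < 1 := Real.rpow_lt_one (by norm_num) (by norm_num) hl0
    linarith
  have hr : 0 < -coord (1 - 2 / lam) ε := neg_pos.2 (coord_neg hq hq1 hε0.le hε1)
  have hrA : -coord (1 - 2 / lam) ε < amp (1 - 2 / lam) := by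
    linarith [neg_amp_lt_coord hq hq1 hε0]
  refine ⟨_, hr, hrA, ?_⟩
  set r := -coord (1 - 2 / lam) ε with hrdef
  have hr' : |r| < amp (1 - 2 / lam) := by rwa [abs_of_pos hr]
  by_contra! hcon
  obtain ⟨k, dh, hk, hh, hd⟩ := exists_isPosSolution_root hlam hr hrA
  have h0 : dh 0 = 0 := hd 0 (by rw [mul_zero, dsol_zero hq hq1 hr'])
  have hT := period_pos hq hq1 hr'
  have hle : period (1 - 2 / lam) r / 2 / lam ≤ Real.pi / 3 := by
    rw [div_le_iff₀ hl0]; linarith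
  have hπ := Real.pi_pos
  have hnn : 0 ≤ period (1 - 2 / lam) r / 2 / lam := by positivity
  have key := hh.mul_cos_le hk h0 hnn (hle.trans (by linarith))
  rw [mul_div_cancel₀ _ hl0.ne', mul_zero, (sol_half_period hq hq1 hr').1, sol_zero hq hq1 hr',
    hrdef, neg_neg, coordInv_coord hq hq1 hε0, ← hrdef] at key
  have hc : 1 / 2 ≤ Real.cos (period (1 - 2 / lam) r / 2 / lam) := by
    rw [← Real.cos_pi_div_three]
    exact Real.cos_le_cos_of_nonneg_of_le_pi hnn (by linarith) hle
  have h1 : 1 ≤ coordInv (1 - 2 / lam) r ^ (1 / lam) := by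
    refine Real.one_le_rpow ?_ (by positivity)
    have hA := amp_pos hq hq1
    have h := strictMonoOn_coordInv hq hq1 (mem_Ioi.2 (by linarith)) (mem_Ioi.2 (by linarith)) hr
    rw [coordInv_zero hq hq1] at h
    exact h.le
  have h2 : 1 / 2 ≤ ε ^ (1 / lam) := by
    have := mul_le_mul h1 hc (by norm_num) (by linarith)
    linarith
  have h3 := Real.rpow_le_rpow (by norm_num) h2 hl0.le
  rw [← Real.rpow_mul hε0.le, one_div_mul_cancel hl0.ne', Real.rpow_one] at h3
  linarith

theorem lam_mul_sqrt (hlam : 0 < lam) : lam * √(1 - (1 - 2 / lam)) = √(2 * lam) := by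
  rw [sub_sub_cancel, ← Real.sqrt_sq hlam.le, ← Real.sqrt_mul (sq_nonneg lam),
    Real.sqrt_sq hlam.le]
  congr 1
  field_simp

/-- The values of the period function. -/
theorem exists_period_eq (hlam : 2 < lam) {n : ℕ} (hn : 2 < (n : ℝ)) (hn' : (n : ℝ) < √(2 * lam)) :
    ∃ r, 0 < r ∧ r < amp (1 - 2 / lam) ∧ n * period (1 - 2 / lam) r = 2 * Real.pi * lam := by
  obtain ⟨hq, hq1⟩ := exponent_mem hlam
  have hl0 : 0 < lam := by linarith
  have hn3 : (3 : ℝ) ≤ n := by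
    have : 2 < n := by exact_mod_cast hn
    exact_mod_cast this
  have hn0 : (0 : ℝ) < n := by linarith
  have hπ := Real.pi_pos
  obtain ⟨R, hR, hRA, hRT⟩ := exists_lt_period hlam
  have h0 : period (1 - 2 / lam) 0 < 2 * Real.pi * lam / n := by
    rw [period_zero hq hq1, div_lt_div_iff₀ (Real.sqrt_pos.2 (by linarith)) hn0, mul_assoc _ lam,
      lam_mul_sqrt hl0]
    exact mul_lt_mul_of_pos_left hn' Real.two_pi_pos
  have h1 : 2 * Real.pi * lam / n ≤ 2 * Real.pi * lam / 3 :=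
    div_le_div_of_nonneg_left (by positivity) (by norm_num) hn3
  obtain ⟨r, hr, hrT⟩ := intermediate_value_Icc hR.le (continuousOn_period hq hq1 hRA)
    ⟨h0.le, (h1.trans hRT.le)⟩
  refine ⟨r, lt_of_le_of_ne hr.1 ?_, hr.2.trans_lt hRA, ?_⟩
  · rintro rfl
    exact h0.ne hrT
  · rw [hrT, mul_div_cancel₀ _ hn0.ne']

/-- The lower bound on `n` is the Sturm bound on the period; the upper one is its monotonicity,
compared with the linearised period at amplitude `0`. -/
theorem lt_of_period_eq (hlam : 2 < lam) {n : ℕ} (hr : 0 < r) (hrA : r < amp (1 - 2 / lam))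
    (h : n * period (1 - 2 / lam) r = 2 * Real.pi * lam) :
    2 < (n : ℝ) ∧ (n : ℝ) < √(2 * lam) := by
  obtain ⟨hq, hq1⟩ := exponent_mem hlam
  have hl0 : 0 < lam := by linarith
  have hπ := Real.pi_pos
  have hT := period_pos hq hq1 (by rwa [abs_of_pos hr])
  have hn0 : (0 : ℝ) < n := by
    have : 0 < n * period (1 - 2 / lam) r := by rw [h]; positivity
    exact pos_of_mul_pos_left this hT.le
  constructor
  · have h1 := mul_lt_mul_of_pos_left (period_lt hlam hr hrA) hn0
    rw [h] at h1
    have h2 : 2 * (Real.pi * lam) < n * (Real.pi * lam) := by linarith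
    exact lt_of_mul_lt_mul_right h2 (by positivity)
  · have h1 := strictMonoOn_period hq hq1 ⟨le_rfl, hr.trans hrA⟩ ⟨hr.le, hrA⟩ hr
    have h2 := mul_lt_mul_of_pos_left h1 hn0
    rw [h, period_zero hq hq1, mul_div_assoc', div_lt_iff₀ (Real.sqrt_pos.2 (by linarith)),
      mul_assoc _ lam, lam_mul_sqrt hl0, mul_comm] at h2
    exact lt_of_mul_lt_mul_left h2 Real.two_pi_pos.le

end Emden

/-! ### Counting profiles up to symmetry. -/

theorem SymmEquiv.periodic {ψ φ : ℝ → ℝ} (h : SymmEquiv ψ φ) {T : ℝ}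
    (hT : Function.Periodic ψ T) : Function.Periodic φ T := by
  obtain ⟨α, -, s, hs, θ₀, h⟩ := h
  intro θ
  rw [h, h]
  rcases hs with rfl | rfl
  · rw [show 1 * (θ + T) - θ₀ = (1 * θ - θ₀) + T by ring, hT]
  · rw [show -1 * (θ + T) - θ₀ = (-1 * θ - θ₀) - T by ring, hT.sub_eq]

open Emden

theorem sol_mem_nontrivialElliptic {lam r : ℝ} (hlam : 2 < lam) {n : ℕ} (hr : 0 < r)
    (hrA : r < amp (1 - 2 / lam)) (h : n * period (1 - 2 / lam) r = 2 * Real.pi * lam) :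
    (fun θ => sol (1 - 2 / lam) r (lam * θ)) ∈ nontrivialElliptic lam := by
  obtain ⟨hq, hq1⟩ := exponent_mem hlam
  have hs := isPosSolution_profile hlam (r := r) (by rwa [abs_of_pos hr])
  refine ⟨⟨hs.isProfile (by linarith) (by linarith), fun θ => (hs.pos θ).ne'⟩, fun θ => ?_, ?_⟩
  · have h1 := (periodic_sol_iff hq hq1 hr hrA (τ := 2 * Real.pi * lam)).2 ⟨n, by simpa using h.symm⟩
    beta_reduce
    rw [show lam * (θ + 2 * Real.pi) = lam * θ + 2 * Real.pi * lam by ring, h1]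
  · rintro ⟨c, hc⟩
    refine not_const_sol hq hq1 hr hrA ⟨c, fun t => ?_⟩
    have hl0 : 0 < lam := by linarith
    have := hc (t / lam)
    beta_reduce at this
    rwa [mul_div_cancel₀ _ hl0.ne'] at this

theorem exists_symmEquiv_sol {lam : ℝ} (hlam : 2 < lam) {ψ : ℝ → ℝ}
    (hψ : ψ ∈ nontrivialElliptic lam) : ∃ (n : ℕ) (r : ℝ), 0 < r ∧ r < amp (1 - 2 / lam) ∧
      n * period (1 - 2 / lam) r = 2 * Real.pi * lam ∧
      SymmEquiv ψ (fun θ => sol (1 - 2 / lam) r (lam * θ)) := by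
  obtain ⟨hell, hper, hnc⟩ := hψ
  obtain ⟨hq, hq1⟩ := exponent_mem hlam
  have hl0 : 0 < lam := by linarith
  have hπ := Real.pi_pos
  obtain ⟨ε, hε, P, hP, hpos⟩ := hell.exists_sign
  have hε0 : ε ≠ 0 := by rcases hε with rfl | rfl <;> norm_num
  obtain ⟨c, hs⟩ := hP.exists_isPosSolution hl0 hpos
  have hc : 0 < c := by
    obtain ⟨t, ht⟩ := hs.exists_nonneg_of_periodic Real.two_pi_pos
      (fun θ => by simp only [hper θ])
    by_contra hcon
    have h2 : 0 < (ε * ψ t) ^ (1 - 2 / lam) := Real.rpow_pos_of_pos (hpos t) _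
    have h3 := mul_nonpos_of_nonpos_of_nonneg (not_lt.1 hcon) h2.le
    have h4 := mul_pos (pow_pos hl0 2) (hpos t)
    linarith
  set q := 1 - 2 / lam with hqdef
  -- Together with the time scale `1 / lam`, this factor normalises both coefficients of the
  -- equation to `1`.
  set b : ℝ := (lam ^ 2 / c) ^ (1 / (1 - q)) with hb
  have hb0 : 0 < b := by positivity
  have hbq : b ^ q = b * c / lam ^ 2 := by
    have h1 : b ^ (1 - q) = lam ^ 2 / c := by
      rw [hb, ← Real.rpow_mul (by positivity), one_div_mul_cancel (by linarith), Real.rpow_one]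
    rw [rpow_one_sub hb0] at h1
    have : 0 < b ^ q := Real.rpow_pos_of_pos hb0 q
    field_simp at h1 ⊢
    linarith
  have hu := hs.scale (b := b) (s := 1 / lam) (G := fun x => 1 * x ^ q - x) hb0 fun x hx => by
    rw [Real.mul_rpow hb0.le hx.le, hbq]
    field_simp
  have huper : Function.Periodic (fun t => b * (ε * ψ (1 / lam * t))) (2 * Real.pi * lam) := by
    intro t
    simp only
    rw [show 1 / lam * (t + 2 * Real.pi * lam) = 1 / lam * t + 2 * Real.pi by field_simp, hper]
  have hunc : ¬ ∃ c, ∀ t, b * (ε * ψ (1 / lam * t)) = c := by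
    rintro ⟨d, hd⟩
    refine hnc ⟨d / (b * ε), fun θ => ?_⟩
    have := hd (lam * θ)
    rw [← mul_assoc (1 / lam), one_div_mul_cancel hl0.ne', one_mul] at this
    rw [← this]
    field_simp
  obtain ⟨r, a, hr, hrA, hra⟩ := exists_eq_sol hq hq1 hu (by positivity) huper hunc
  have hsper : Function.Periodic (sol q r) (2 * Real.pi * lam) := fun t => by
    have h := huper (t + a)
    beta_reduce at h
    rw [← hra, ← hra, ← h, add_right_comm]
  obtain ⟨m, hm⟩ := (periodic_sol_iff hq hq1 hr hrA).1 hsper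
  have hT := period_pos hq hq1 (r := r) (by rwa [abs_of_pos hr])
  have hm0 : (0 : ℝ) < m := by
    have : 0 < m * period q r := by rw [← hm]; positivity
    exact pos_of_mul_pos_left this hT.le
  have hm0' : 0 ≤ m := by
    have : 0 < m := by exact_mod_cast hm0
    exact this.le
  obtain ⟨n, rfl⟩ := Int.eq_ofNat_of_zero_le hm0'
  refine ⟨n, r, hr, hrA, by simpa using hm.symm, b * ε, mul_ne_zero hb0.ne' hε0, 1, Or.inl rfl,
    -(a / lam), fun θ => ?_⟩
  beta_reduce
  rw [← hra (lam * θ), ← mul_assoc, show 1 / lam * (lam * θ + a) = 1 * θ - -(a / lam) by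
    field_simp; ring]

theorem encard_nontrivialElliptic {lam : ℝ} (hlam : 2 < lam) :
    (Quotient.mk symmSetoid '' nontrivialElliptic lam).encard
      = {n : ℕ | 2 < (n : ℝ) ∧ (n : ℝ) < Real.sqrt (2 * lam)}.encard := by
  obtain ⟨hq, hq1⟩ := exponent_mem hlam
  have hl0 : 0 < lam := by linarith
  have hπ := Real.pi_pos
  have hex : ∀ n : ℕ, ∃ r, (2 < (n : ℝ) ∧ (n : ℝ) < √(2 * lam)) →
      0 < r ∧ r < amp (1 - 2 / lam) ∧ n * period (1 - 2 / lam) r = 2 * Real.pi * lam := by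
    intro n
    by_cases h : 2 < (n : ℝ) ∧ (n : ℝ) < √(2 * lam)
    · obtain ⟨r, hr⟩ := exists_period_eq hlam h.1 h.2
      exact ⟨r, fun _ => hr⟩
    · exact ⟨0, fun h' => absurd h' h⟩
  choose ρ hρ using hex
  set g : ℕ → Quotient symmSetoid := fun n =>
    Quotient.mk symmSetoid fun θ => sol (1 - 2 / lam) (ρ n) (lam * θ) with hg
  have himage : Quotient.mk symmSetoid '' nontrivialElliptic lam
      = g '' {n : ℕ | 2 < (n : ℝ) ∧ (n : ℝ) < √(2 * lam)} := by
    ext x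
    constructor
    · rintro ⟨ψ, hψ, rfl⟩
      obtain ⟨n, r, hr, hrA, hn, hsymm⟩ := exists_symmEquiv_sol hlam hψ
      have hnN := lt_of_period_eq hlam hr hrA hn
      obtain ⟨h1, h2, h3⟩ := hρ n hnN
      have hn0 : (n : ℝ) ≠ 0 := by linarith [hnN.1]
      have : r = ρ n := (strictMonoOn_period hq hq1).injOn ⟨hr.le, hrA⟩ ⟨h1.le, h2⟩
        (mul_left_cancel₀ hn0 (hn.trans h3.symm))
      refine ⟨n, hnN, (Quotient.sound ?_).symm⟩
      rw [← this]
      exact hsymm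
    · rintro ⟨n, hn, rfl⟩
      obtain ⟨h1, h2, h3⟩ := hρ n hn
      exact ⟨_, sol_mem_nontrivialElliptic hlam h1 h2 h3, rfl⟩
  -- Equivalent profiles share their periods, so the minimal period for `n` is an integer multiple
  -- of that for `m`; exchanging the roles then gives `n = m`.
  have hdvd : ∀ n m : ℕ, (2 < (n : ℝ) ∧ (n : ℝ) < √(2 * lam)) →
      (2 < (m : ℝ) ∧ (m : ℝ) < √(2 * lam)) → g n = g m → n ∣ m := by
    intro n m hn hm h
    obtain ⟨h1, h2, h3⟩ := hρ n hn
    obtain ⟨k1, k2, k3⟩ := hρ m hm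
    have hsymm : SymmEquiv _ _ := Quotient.exact h
    have hn0 : (0 : ℝ) < n := by linarith [hn.1]
    have hTm := period_pos hq hq1 (r := ρ m) (by rwa [abs_of_pos k1])
    have hTn := period_pos hq hq1 (r := ρ n) (by rwa [abs_of_pos h1])
    have hp : Function.Periodic (fun θ => sol (1 - 2 / lam) (ρ n) (lam * θ))
        (period (1 - 2 / lam) (ρ n) / lam) := fun θ => by
      have := (periodic_sol_iff hq hq1 h1 h2).2 ⟨1, by rw [Int.cast_one, one_mul]⟩
      beta_reduce
      rw [mul_add, mul_div_cancel₀ _ hl0.ne', this]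
    have hp' : Function.Periodic (sol (1 - 2 / lam) (ρ m)) (period (1 - 2 / lam) (ρ n)) :=
      fun t => by
        have := hsymm.periodic hp (t / lam)
        beta_reduce at this
        rwa [mul_add, mul_div_cancel₀ _ hl0.ne', mul_div_cancel₀ _ hl0.ne'] at this
    obtain ⟨j, hj⟩ := (periodic_sol_iff hq hq1 k1 k2).1 hp'
    have e : (m : ℝ) * period (1 - 2 / lam) (ρ m)
        = (n * j : ℝ) * period (1 - 2 / lam) (ρ m) := by
      rw [k3, ← h3, hj]; ring
    have e' := mul_right_cancel₀ hTm.ne' e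
    have e'' : (m : ℤ) = n * j := by exact_mod_cast e'
    exact Int.natCast_dvd_natCast.1 ⟨j, e''⟩
  have hinj : InjOn g {n : ℕ | 2 < (n : ℝ) ∧ (n : ℝ) < √(2 * lam)} := fun n hn m hm h =>
    Nat.dvd_antisymm (hdvd n m hn hm h) (hdvd m n hm hn h.symm)
  rw [himage, hinj.encard_image]

theorem nontrivialElliptic_eq_empty_of_le {lam : ℝ} (hlam : 2 < lam) (hlam' : lam ≤ 9 / 2) :
    nontrivialElliptic lam = ∅ := by
  have h := encard_nontrivialElliptic hlam
  have hN : {n : ℕ | 2 < (n : ℝ) ∧ (n : ℝ) < Real.sqrt (2 * lam)} = ∅ := by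
    rw [eq_empty_iff_forall_notMem]
    rintro n ⟨h1, h2⟩
    have h3 : (3 : ℝ) ≤ n := by
      have : 2 < n := by exact_mod_cast h1
      exact_mod_cast this
    -- The threshold `9 / 2` is where `√(2 * lam)` reaches `3`, the first admissible integer.
    have h4 : √(2 * lam) ≤ 3 := Real.sqrt_le_iff.2 ⟨by norm_num, by linarith⟩
    linarith
  rw [hN, encard_empty, encard_eq_zero, image_eq_empty] at h
  exact h

theorem mainTheorem2 (lam : ℝ) (hlam : 0 < lam) (hlam1 : lam ≠ 1) :
    -- the trivial (rotational) solutions always exist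
    (∀ c : ℝ, c ≠ 0 → IsElliptic lam (fun _ => c)) ∧
    -- no non-trivial elliptic solutions
    (lam ∈ Set.Ico (4 / 3 : ℝ) 2 ∪ Set.Ioc (2 : ℝ) (9 / 2) → nontrivialElliptic lam = ∅) ∧
    -- the number of non-trivial elliptic solutions, up to symmetries
    (2 < lam →
      (Quotient.mk symmSetoid '' nontrivialElliptic lam).encard
        = {n : ℕ | 2 < (n : ℝ) ∧ (n : ℝ) < Real.sqrt (2 * lam)}.encard) ∧
    -- at `lam = 2` all elliptic solutions are periodic, and they are explicit
    (lam = 2 → ∀ ψ : ℝ → ℝ,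
      (IsElliptic lam ψ → Function.Periodic ψ (2 * Real.pi)) ∧
      (IsElliptic lam ψ ↔ ∃ γ₁ γ₂ θ₀ : ℝ, |γ₂| < |γ₁| ∧
        ∀ θ, ψ θ = γ₁ + γ₂ * Real.cos (2 * (θ - θ₀)))) ∧
    -- the conjugate case `lam = 1 / 2`
    (lam = 1 / 2 → ∀ ψ : ℝ → ℝ,
      (IsElliptic lam ψ → Function.Periodic ψ (2 * Real.pi)) ∧
      (IsElliptic lam ψ ↔ ∃ ε γ₁ γ₂ θ₀ : ℝ, (ε = 1 ∨ ε = -1) ∧ |γ₂| < γ₁ ∧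
        ∀ θ, ψ θ = ε * Real.sqrt (γ₁ + γ₂ * Real.cos (θ - θ₀)))) ∧
    -- the conjugate ranges without non-trivial elliptic solutions
    (lam ∈ Set.Ioo (0 : ℝ) (1 / 2) ∪ Set.Ioc (1 / 2 : ℝ) (3 / 4) → nontrivialElliptic lam = ∅) := by
  refine ⟨fun c hc => isElliptic_const hlam1 hc, ?_, encard_nontrivialElliptic, ?_, ?_, ?_⟩
  · rintro (h | h)
    · exact nontrivialElliptic_eq_empty hlam h.2 (by linarith [h.1] : lam > 1 / 2).ne'
    · exact nontrivialElliptic_eq_empty_of_le h.1 h.2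
  · rintro rfl ψ
    exact ⟨periodic_of_isElliptic_two, isElliptic_two_iff⟩
  · rintro rfl ψ
    exact ⟨periodic_of_isElliptic_half, isElliptic_half_iff⟩
  · rintro (h | h)
    · exact nontrivialElliptic_eq_empty hlam (by linarith [h.2]) h.2.ne
    · exact nontrivialElliptic_eq_empty hlam (by linarith [h.2]) h.1.ne'
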